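/- **Theorem 1.1.** Let $n,k\ge 0$ be integers and let $V=V(n,k)$ be the set of I-states, i.e. $k$-element subsets $\mathbf x=\{x_1<\dots<x_k\}$ of $\{0,1,\dots,n\}$. For $\mathbf x,\mathbf y\in V$ and $1\le i\le n$ put $v_i(\mathbf x,\mathbf y)=|\mathbf y\cap[i,n]|-|\mathbf x\cap[i,n]|$ and $|v|_i=|v_i|$. Products in path algebras are read from left to right ($pq$ means first $p$, then $q$), and $\mathbf I_{\mathbf x}$ denotes the empty path at $\mathbf x$. *The algebra $\mathcal B_0(n,k)$.* It is the path algebra over $\mathbb F_2[U_1,\dots,U_n]$ of the complete directed graph on $V$, with one edge $f_{\mathbf x,\mathbf y}$ for each $(\mathbf x,\mathbf y)\in V^2$, modulo the two-sided ideal generated by the relations $$f_{\mathbf x,\mathbf x}=\mathbf I_{\mathbf x},\qquad f_{\mathbf x,\mathbf y}f_{\mathbf y,\mathbf z}=\prod_{i=1}^n U_i^{(|v|_i(\mathbf y,\mathbf z)-|v|_i(\mathbf x,\mathbf z)+|v|_i(\mathbf x,\mathbf y))/2}\,f_{\mathbf x,\mathbf z}\qquad(\mathbf x,\mathbf y,\mathbf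 z\in V).$$ *The quiver algebra.* Let $\Gamma(n,k)$ be the quiver with vertex set $V$ and, for $1\le i\le n$, the following arrows: an arrow labelled $R_i$ from $\mathbf x$ to $(\mathbf x\setminus\{i-1\})\cup\{i\}$ whenever $i-1\in\mathbf x$, $i\notin\mathbf x$; an arrow labelled $L_i$ from $\mathbf x$ to $(\mathbf x\setminus\{i\})\cup\{i-1\}$ whenever $i\in\mathbf x$, $i-1\notin\mathbf x$; and a loop labelled $U_i$ at every $\mathbf x$. Let $\mathcal Q(n,k)$ be the path algebra of $\Gamma(n,k)$ over $\mathbb F_2$ modulo the two-sided ideal generated by all differences of two paths with the same start and the same end whose label words form one of the following pairs: * ($U$ central) $R_iU_j$ and $U_jR_i$; $L_iU_j$ and $U_jL_i$; $U_iU_j$ and $U_jU_i$; * (loop) $R_iL_i$ and $U_i$; $L_iR_i$ and $U_i$; * (distant commutation) $R_iR_j$ and $R_jR_i$; $L_iL_j$ and $L_jL_i$; $R_iL_j$ and $L_jR_i$, for $|i-j|>1$. In $\mathcal Q(n,k)$ the sum over all vertices of the loops labelled $U_i$ is central, so $\mathcal Q(n,k)$ is an algebra over $\mathbb F_2[U_1,\dots,U_n]$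 with $U_i$ acting as this sum. Both $\mathcal B_0(n,k)$ and $\mathcal Q(n,k)$ are algebras over $\mathbb F_2[U_1,\dots,U_n]^{V}$ (i.e. rings with a ring homomorphism from it) through $(p_{\mathbf x})_{\mathbf x}\mapsto\sum_{\mathbf x}p_{\mathbf x}\mathbf I_{\mathbf x}$. *The paths $\gamma_{\mathbf x,\mathbf y}$.* Paths $\gamma_{\mathbf x,\mathbf y}$ from $\mathbf x$ to $\mathbf y$ in $\Gamma(n,k)$ are uniquely determined by the following recursion. If $\mathbf x=\mathbf y$, the path is empty. If $x_a<y_a$ for some $a$, take the largest such $a$, put $\mathbf x'=(\mathbf x\setminus\{x_a\})\cup\{y_a\}$, and let $\gamma_{\mathbf x,\mathbf y}$ be the path from $\mathbf x$ to $\mathbf x'$ with labels $R_{x_a+1},\dots,R_{y_a}$ in this order, followed by $\gamma_{\mathbf x',\mathbf y}$. If $x_b\ge y_b$ for all $b$ but $\mathbf x\ne\mathbf y$, take the smallest $a$ with $x_a>y_a$, put $\mathbf x'=(\mathbf x\setminus\{x_a\})\cup\{y_a\}$, and let $\gamma_{\mathbf x,\mathbf y}$ be the path from $\mathbf x$ to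 $\mathbf x'$ with labels $L_{x_a},L_{x_a-1},\dots,L_{y_a+1}$ in this order, followed by $\gamma_{\mathbf x',\mathbf y}$. *Claim.* There is an isomorphism $F:\mathcal Q(n,k)\to\mathcal B_0(n,k)$ of $\mathbb F_2[U_1,\dots,U_n]^{V}$-algebras which sends every arrow from $\mathbf x$ to $\mathbf y$ labelled $R_i$ or $L_i$ to $f_{\mathbf x,\mathbf y}$, and whose inverse $G$ sends $f_{\mathbf x,\mathbf y}$ to the class of $\gamma_{\mathbf x,\mathbf y}$ for all $\mathbf x,\mathbf y\in V$. -/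

import Mathlib

noncomputable section

/-! ### Path algebras of quivers with relations -/

namespace OSz

universe u

/-- Paths in a quiver that is passed explicitly (several quivers on the same vertex set occur). -/
abbrev QPath {V : Type u} (Q : Quiver.{0} V) (x y : V) : Type u := @Quiver.Path V Q x y

/-- The path of length one given by an arrow. -/
abbrev arrowPath {V : Type u} (Q : Quiver.{0} V) {x y : V} (e : Q.Hom x y) : QPath Q x y :=
  @Quiver.Hom.toPath V Q x y e

/-- All paths of a quiver, together with their start and end. -/
abbrev AnyPath {V : Type u} (Q : Quiver.{0} V) : Type u := Σ x y : V, QPath Q x y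

/-- The path algebra of `Q` over `𝕜`: the free `𝕜`-module on all paths (including the empty path
at each vertex).  The product `p * q` of two paths is the concatenation "first `p`, then `q`" if `p`
ends where `q` starts, and `0` otherwise. -/
def PathAlgebra (𝕜 : Type*) [CommRing 𝕜] {V : Type u} (Q : Quiver.{0} V) : Type _ :=
  AnyPath Q →₀ 𝕜

section PathAlgebra

variable {𝕜 : Type*} [CommRing 𝕜] {V : Type u} {Q : Quiver.{0} V}

instance : AddCommGroup (PathAlgebra 𝕜 Q) := inferInstanceAs (AddCommGroup (AnyPath Q →₀ 𝕜))

instance : Module 𝕜 (PathAlgebra 𝕜 Q) := inferInstanceAs (Module 𝕜 (AnyPath Q →₀ 𝕜))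

variable (𝕜) in
/-- The basis element of the path algebra given by a path. -/
def ofPath {x y : V} (p : QPath Q x y) : PathAlgebra 𝕜 Q :=
  Finsupp.single (⟨x, y, p⟩ : AnyPath Q) (1 : 𝕜)

/-- The linear map out of the path algebra with given values on the basis of paths. -/
def extendLin {M : Type*} [AddCommGroup M] [Module 𝕜 M] (f : AnyPath Q → M) :
    PathAlgebra 𝕜 Q →ₗ[𝕜] M :=
  Finsupp.linearCombination 𝕜 f

theorem extendLin_ofPath {M : Type*} [AddCommGroup M] [Module 𝕜 M] (f : AnyPath Q → M) {x y : V}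
    (p : QPath Q x y) : extendLin f (ofPath 𝕜 p) = f ⟨x, y, p⟩ :=
  (Finsupp.linearCombination_single 𝕜 (1 : 𝕜) _).trans (one_smul 𝕜 _)

variable (𝕜) in
open Classical in
/-- The product of two basis elements. -/
def mulPath (p q : AnyPath Q) : PathAlgebra 𝕜 Q :=
  if h : q.1 = p.2.1 then ofPath 𝕜 (p.2.2.comp (q.2.2.cast h rfl)) else 0

variable (𝕜 Q) in
/-- The bilinear extension of the product of paths. -/
def mulBilin : PathAlgebra 𝕜 Q →ₗ[𝕜] PathAlgebra 𝕜 Q →ₗ[𝕜] PathAlgebra 𝕜 Q :=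
  extendLin fun p => extendLin fun q => mulPath 𝕜 p q

instance : Mul (PathAlgebra 𝕜 Q) := ⟨fun a b => mulBilin 𝕜 Q a b⟩

theorem mul_eq_mulBilin (a b : PathAlgebra 𝕜 Q) : a * b = mulBilin 𝕜 Q a b := rfl

variable (𝕜) in
theorem ofPath_mul_ofPath {x y z : V} (p : QPath Q x y) (q : QPath Q y z) :
    ofPath 𝕜 p * ofPath 𝕜 q = ofPath 𝕜 (p.comp q) := by
  rw [mul_eq_mulBilin, mulBilin, extendLin_ofPath, extendLin_ofPath]
  simp [mulPath]

variable (𝕜) in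
theorem ofPath_mul_ofPath_of_ne {x y y' z : V} (p : QPath Q x y) (q : QPath Q y' z) (h : y ≠ y') :
    ofPath 𝕜 p * ofPath 𝕜 q = 0 := by
  rw [mul_eq_mulBilin, mulBilin, extendLin_ofPath, extendLin_ofPath]
  simp [mulPath, h.symm]

/-- Every element of the path algebra is a linear combination of paths. -/
theorem path_induction {P : PathAlgebra 𝕜 Q → Prop} (h0 : P 0)
    (hadd : ∀ a b, P a → P b → P (a + b))
    (hp : ∀ (c : 𝕜) (x y : V) (p : QPath Q x y), P (c • ofPath 𝕜 p)) (a : PathAlgebra 𝕜 Q) :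
    P a := by
  refine Finsupp.induction_linear (motive := P) a h0 hadd fun p c => ?_
  obtain ⟨x, y, p⟩ := p
  have := hp c x y p
  rw [ofPath] at this
  erw [Finsupp.smul_single] at this
  simpa using this

theorem smul_mul_aux (c : 𝕜) (a b : PathAlgebra 𝕜 Q) : c • a * b = c • (a * b) := by
  simp [mul_eq_mulBilin]

theorem mul_smul_aux (c : 𝕜) (a b : PathAlgebra 𝕜 Q) : a * c • b = c • (a * b) := by
  simp [mul_eq_mulBilin]

theorem add_mul_aux (a b c : PathAlgebra 𝕜 Q) : (a + b) * c = a * c + b * c := by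
  simp [mul_eq_mulBilin]

theorem mul_add_aux (a b c : PathAlgebra 𝕜 Q) : a * (b + c) = a * b + a * c := by
  simp [mul_eq_mulBilin]

theorem zero_mul_aux (a : PathAlgebra 𝕜 Q) : 0 * a = 0 := by
  simp [mul_eq_mulBilin]

theorem mul_zero_aux (a : PathAlgebra 𝕜 Q) : a * 0 = 0 := by
  simp [mul_eq_mulBilin]

theorem mul_assoc_aux (a b c : PathAlgebra 𝕜 Q) : a * b * c = a * (b * c) := by
  induction a using path_induction with
  | h0 => simp only [zero_mul_aux]
  | hadd a a' h h' => simp only [add_mul_aux, h, h']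
  | hp s x y p =>
  induction b using path_induction with
  | h0 => simp only [zero_mul_aux, mul_zero_aux]
  | hadd a a' h h' => simp only [add_mul_aux, mul_add_aux, h, h']
  | hp t x' y' q =>
  induction c using path_induction with
  | h0 => simp only [mul_zero_aux]
  | hadd a a' h h' => simp only [mul_add_aux, h, h']
  | hp r x'' y'' w =>
  simp only [smul_mul_aux, mul_smul_aux]
  congr 3
  by_cases h : y = x'
  · subst h
    by_cases h' : y' = x''
    · subst h'
      simp only [ofPath_mul_ofPath, Quiver.Path.comp_assoc]
    · rw [ofPath_mul_ofPath, ofPath_mul_ofPath_of_ne 𝕜 _ _ h', ofPath_mul_ofPath_of_ne 𝕜 _ _ h',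
        mul_zero_aux]
  · rw [ofPath_mul_ofPath_of_ne 𝕜 _ _ h, zero_mul_aux]
    by_cases h' : y' = x''
    · subst h'
      rw [ofPath_mul_ofPath, ofPath_mul_ofPath_of_ne 𝕜 _ _ h]
    · rw [ofPath_mul_ofPath_of_ne 𝕜 _ _ h', mul_zero_aux]

variable (𝕜 Q) in
/-- The idempotent `I_v`: the empty path at `v`. -/
def idem (v : V) : PathAlgebra 𝕜 Q := ofPath 𝕜 (@Quiver.Path.nil V Q v)

variable [Fintype V]

instance : One (PathAlgebra 𝕜 Q) := ⟨∑ v, idem 𝕜 Q v⟩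

theorem one_eq_sum_idem : (1 : PathAlgebra 𝕜 Q) = ∑ v, idem 𝕜 Q v := rfl

theorem one_mul_aux (a : PathAlgebra 𝕜 Q) : 1 * a = a := by
  classical
  induction a using path_induction with
  | h0 => simp only [mul_zero_aux]
  | hadd a a' h h' => simp only [mul_add_aux, h, h']
  | hp s x y p =>
  rw [one_eq_sum_idem, mul_eq_mulBilin, map_sum, LinearMap.sum_apply, Finset.sum_eq_single x]
  · rw [← mul_eq_mulBilin, mul_smul_aux, idem, ofPath_mul_ofPath, Quiver.Path.nil_comp]
  · intro b _ hb
    rw [← mul_eq_mulBilin, mul_smul_aux, idem, ofPath_mul_ofPath_of_ne 𝕜 _ _ hb, smul_zero]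
  · simp

theorem mul_one_aux (a : PathAlgebra 𝕜 Q) : a * 1 = a := by
  classical
  induction a using path_induction with
  | h0 => simp only [zero_mul_aux]
  | hadd a a' h h' => simp only [add_mul_aux, h, h']
  | hp s x y p =>
  rw [one_eq_sum_idem, mul_eq_mulBilin, map_sum, Finset.sum_eq_single y]
  · rw [← mul_eq_mulBilin, smul_mul_aux, idem, ofPath_mul_ofPath, Quiver.Path.comp_nil]
  · intro b _ hb
    rw [← mul_eq_mulBilin, smul_mul_aux, idem, ofPath_mul_ofPath_of_ne 𝕜 _ _ hb.symm, smul_zero]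
  · simp

instance : Ring (PathAlgebra 𝕜 Q) where
  left_distrib := mul_add_aux
  right_distrib := add_mul_aux
  zero_mul := zero_mul_aux
  mul_zero := mul_zero_aux
  mul_assoc := mul_assoc_aux
  one_mul := one_mul_aux
  mul_one := mul_one_aux
  neg_add_cancel := neg_add_cancel
  zsmul := (· • ·)
  zsmul_zero' := SubNegMonoid.zsmul_zero'
  zsmul_succ' := SubNegMonoid.zsmul_succ'
  zsmul_neg' := SubNegMonoid.zsmul_neg'
  sub_eq_add_neg := sub_eq_add_neg

instance : Algebra 𝕜 (PathAlgebra 𝕜 Q) := Algebra.ofModule smul_mul_aux mul_smul_aux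

theorem completeOrthogonalIdempotents_idem :
    CompleteOrthogonalIdempotents (idem 𝕜 Q) where
  idem v := by
    rw [IsIdempotentElem, idem, ofPath_mul_ofPath, Quiver.Path.nil_comp]
  ortho v w h := ofPath_mul_ofPath_of_ne 𝕜 _ _ h
  complete := one_eq_sum_idem.symm

/-- The quiver algebra with relations: the path algebra of `Q` over `𝕜` modulo the two-sided ideal
generated by `R`. -/
def QuiverAlgebra (R : Set (PathAlgebra 𝕜 Q)) : Type _ := (TwoSidedIdeal.span R).ringCon.Quotient

variable {R : Set (PathAlgebra 𝕜 Q)}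

instance : Ring (QuiverAlgebra R) :=
  inferInstanceAs (Ring (TwoSidedIdeal.span R).ringCon.Quotient)

instance : Algebra 𝕜 (QuiverAlgebra R) :=
  inferInstanceAs (Algebra 𝕜 (TwoSidedIdeal.span R).ringCon.Quotient)

/-- The quotient map from the path algebra. -/
def toQuiv (R : Set (PathAlgebra 𝕜 Q)) : PathAlgebra 𝕜 Q →ₐ[𝕜] QuiverAlgebra R :=
  (TwoSidedIdeal.span R).ringCon.mkₐ 𝕜

theorem toQuiv_surjective : Function.Surjective (toQuiv R) :=
  (TwoSidedIdeal.span R).ringCon.mkₐ_surjective (α := 𝕜)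

theorem toQuiv_eq {a b : PathAlgebra 𝕜 Q} (h : a - b ∈ R) : toQuiv R a = toQuiv R b :=
  (RingCon.eq _).2 ((TwoSidedIdeal.rel_iff _ _ _).2 (TwoSidedIdeal.subset_span h))

theorem completeOrthogonalIdempotents_toQuiv :
    CompleteOrthogonalIdempotents fun v => toQuiv R (idem 𝕜 Q v) :=
  completeOrthogonalIdempotents_idem.map (toQuiv R).toRingHom

end PathAlgebra

/-- For a (central) `S`-algebra `A` with a complete family of orthogonal idempotents `e v`, the
(usually not central) ring homomorphism `S^V → A`, `p ↦ ∑ v, p v • e v`. -/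
def idempotentRingHom (S : Type*) [CommRing S] {A : Type*} [Ring A] [Algebra S A] {V : Type*}
    [Fintype V] (e : V → A) (he : CompleteOrthogonalIdempotents e) : (V → S) →+* A where
  toFun p := ∑ v, p v • e v
  map_one' := by simp [he.complete]
  map_zero' := by simp
  map_add' p q := by simp [add_smul, Finset.sum_add_distrib]
  map_mul' p q := by
    classical
    simp [Finset.sum_mul_sum, he.mul_eq, smul_smul, mul_comm]

/-! ### I-states -/

/-- The set `V(n,k)` of I-states: the `k`-element subsets of `{0, …, n}`. -/
def IState (n k : ℕ) : Type := {x : Finset (Fin (n + 1)) // x.card = k}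

instance (n k : ℕ) : Fintype (IState n k) :=
  inferInstanceAs (Fintype {x : Finset (Fin (n + 1)) // x.card = k})

instance (n k : ℕ) : DecidableEq (IState n k) :=
  inferInstanceAs (DecidableEq {x : Finset (Fin (n + 1)) // x.card = k})

/-- The elements `x_1 < ⋯ < x_k` of an I-state, in increasing order. -/
def IState.dot {n k : ℕ} (x : IState n k) (a : Fin k) : Fin (n + 1) := x.1.orderEmbOfFin x.2 a

/-- The minimal relative weight vector `v_i(x,y) = |y ∩ [i,n]| - |x ∩ [i,n]|`, for `1 ≤ i ≤ n`.
Here and below the number `i` is represented by the element `i - 1` of `Fin n`; for `i : Fin n`,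
the represented number is `i.succ : Fin (n + 1)` and its predecessor is `i.castSucc`. -/
def relWeight {n k : ℕ} (x y : IState n k) (i : Fin n) : ℤ :=
  ((y.1.filter (i.succ ≤ ·)).card : ℤ) - ((x.1.filter (i.succ ≤ ·)).card : ℤ)

/-- `|v|_i(y,z) - |v|_i(x,z) + |v|_i(x,y)`. -/
def weightDefect {n k : ℕ} (x y z : IState n k) (i : Fin n) : ℤ :=
  |relWeight y z i| - |relWeight x z i| + |relWeight x y i|

theorem weightDefect_nonneg_even {n k : ℕ} (x y z : IState n k) (i : Fin n) :
    0 ≤ weightDefect x y z i ∧ Even (weightDefect x y z i) := by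
  have h : relWeight x z i = relWeight x y i + relWeight y z i := by
    simp only [relWeight]; ring
  rw [Int.even_iff, weightDefect, h]
  grind

/-- The coefficient ring `𝔽₂[U_1, …, U_n]`. -/
abbrev UPoly (n : ℕ) : Type := MvPolynomial (Fin n) (ZMod 2)

/-- The monomial `∏ U_i ^ ((|v|_i(y,z) - |v|_i(x,z) + |v|_i(x,y)) / 2)`. -/
def weightMonomial {n k : ℕ} (x y z : IState n k) : UPoly n :=
  ∏ i : Fin n, MvPolynomial.X i ^ (weightDefect x y z i / 2).toNat

/-! ### The algebra `B_0(n,k)` -/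

/-- The complete directed graph `K(n,k)`: one arrow `f_{x,y}` for each ordered pair. -/
@[reducible]
def completeQuiver (n k : ℕ) : Quiver.{0} (IState n k) := ⟨fun _ _ => Unit⟩

/-- The element `f_{x,y}` of the path algebra of `K(n,k)` over `𝔽₂[U_1, …, U_n]`. -/
def fArrow {n k : ℕ} (x y : IState n k) : PathAlgebra (UPoly n) (completeQuiver n k) :=
  ofPath (UPoly n) (arrowPath (completeQuiver n k) (x := x) (y := y) ())

/-- The relations of `B_0(n,k)`: `f_{x,x} = I_x`, and `f_{x,y} f_{y,z}` is a monomial in the `U_i`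
times `f_{x,z}`. -/
inductive B0Rel (n k : ℕ) : PathAlgebra (UPoly n) (completeQuiver n k) → Prop
  | unit (x : IState n k) : B0Rel n k (fArrow x x - idem (UPoly n) (completeQuiver n k) x)
  | comp (x y z : IState n k) :
      B0Rel n k (fArrow x y * fArrow y z - weightMonomial x y z • fArrow x z)

/-- The algebra `B_0(n,k)`. -/
abbrev B0 (n k : ℕ) : Type := QuiverAlgebra {r | B0Rel n k r}

/-- The generator `f_{x,y}` of `B_0(n,k)`. -/
def B0.f {n k : ℕ} (x y : IState n k) : B0 n k := toQuiv {r | B0Rel n k r} (fArrow x y)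

/-- The structure of `B_0(n,k)` as an algebra over `𝔽₂[U_1, …, U_n]^{V(n,k)}`. -/
def B0.baseHom (n k : ℕ) : (IState n k → UPoly n) →+* B0 n k :=
  idempotentRingHom (UPoly n) _ completeOrthogonalIdempotents_toQuiv

/-! ### The quiver `Γ(n,k)` and its relations -/

/-- The labels `R_i`, `L_i`, `U_i`, for `1 ≤ i ≤ n`. -/
inductive Label (n : ℕ) : Type
  | R (i : Fin n)
  | L (i : Fin n)
  | U (i : Fin n)

/-- `IsArrow l x y` says that `Γ(n,k)` has an arrow from `x` to `y` with label `l`. -/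
def IsArrow {n k : ℕ} (l : Label n) (x y : IState n k) : Prop :=
  match l with
  | .R i => i.castSucc ∈ x.1 ∧ i.succ ∉ x.1 ∧ y.1 = insert i.succ (x.1 \ {i.castSucc})
  | .L i => i.succ ∈ x.1 ∧ i.castSucc ∉ x.1 ∧ y.1 = insert i.castSucc (x.1 \ {i.succ})
  | .U _ => y = x

/-- The quiver `Γ(n,k)`. -/
@[reducible]
def Gamma (n k : ℕ) : Quiver.{0} (IState n k) := ⟨fun x y => {l : Label n // IsArrow l x y}⟩

/-- The list of labels along a path, in the order in which the path traverses them. -/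
def labels {V : Type u} {Q : Quiver.{0} V} {α : Type*} (lab : ∀ {a b : V}, Q.Hom a b → α) {x : V} :
    {y : V} → QPath Q x y → List α
  | _, .nil => []
  | _, .cons p e => labels lab p ++ [lab e]

/-- The word `μ(γ)` of a path in `Γ(n,k)`. -/
def word {n k : ℕ} {x y : IState n k} (p : QPath (Gamma n k) x y) : List (Label n) :=
  labels (fun {a b} (e : (Gamma n k).Hom a b) => (e.1 : Label n)) p

/-- `WordRel w w'` lists the differences `w - w'` of monomials that define the relations. -/
inductive WordRel {n : ℕ} : List (Label n) → List (Label n) → Prop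
  | central_R (i j : Fin n) : WordRel [.R i, .U j] [.U j, .R i]
  | central_L (i j : Fin n) : WordRel [.L i, .U j] [.U j, .L i]
  | central_U (i j : Fin n) : WordRel [.U i, .U j] [.U j, .U i]
  | loop_RL (i : Fin n) : WordRel [.R i, .L i] [.U i]
  | loop_LR (i : Fin n) : WordRel [.L i, .R i] [.U i]
  | distant_RR (i j : Fin n) (h : 1 < |((i : ℕ) : ℤ) - ((j : ℕ) : ℤ)|) :
      WordRel [.R i, .R j] [.R j, .R i]
  | distant_LL (i j : Fin n) (h : 1 < |((i : ℕ) : ℤ) - ((j : ℕ) : ℤ)|) :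
      WordRel [.L i, .L j] [.L j, .L i]
  | distant_RL (i j : Fin n) (h : 1 < |((i : ℕ) : ℤ) - ((j : ℕ) : ℤ)|) :
      WordRel [.R i, .L j] [.L j, .R i]

/-- The relations in the path algebra of `Γ(n,k)` over `𝔽₂`: the differences `p - q` of paths with
the same start and the same end whose words are related as above. -/
inductive GammaRel (n k : ℕ) : PathAlgebra (ZMod 2) (Gamma n k) → Prop
  | mk {x y : IState n k} (p q : QPath (Gamma n k) x y) (h : WordRel (word p) (word q)) :
      GammaRel n k (ofPath (ZMod 2) p - ofPath (ZMod 2) q)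

/-- The path algebra of `Γ(n,k)` over `𝔽₂` modulo the relations. -/
abbrev GammaAlgebra (n k : ℕ) : Type := QuiverAlgebra {r | GammaRel n k r}

/-- The class of a path of `Γ(n,k)`. -/
def GammaAlgebra.ofPath {n k : ℕ} {x y : IState n k} (p : QPath (Gamma n k) x y) :
    GammaAlgebra n k :=
  toQuiv {r | GammaRel n k r} (OSz.ofPath (ZMod 2) p)

/-- The loop at `x` with label `U_i`. -/
def uLoop {n k : ℕ} (x : IState n k) (i : Fin n) : QPath (Gamma n k) x x :=
  arrowPath (Gamma n k) ⟨Label.U i, rfl⟩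

/-- The element `U_i`: the sum over all vertices of the loops with label `U_i`. -/
def GammaAlgebra.u {n k : ℕ} (i : Fin n) : GammaAlgebra n k :=
  ∑ x : IState n k, GammaAlgebra.ofPath (uLoop x i)

theorem GammaAlgebra.ofPath_mul {n k : ℕ} {x y z : IState n k} (p : QPath (Gamma n k) x y)
    (q : QPath (Gamma n k) y z) :
    GammaAlgebra.ofPath p * GammaAlgebra.ofPath q =
      GammaAlgebra.ofPath (@Quiver.Path.comp _ (Gamma n k) _ _ _ p q) := by
  rw [GammaAlgebra.ofPath, GammaAlgebra.ofPath, ← map_mul, ofPath_mul_ofPath]; rfl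

theorem GammaAlgebra.ofPath_mul_of_ne {n k : ℕ} {x y y' z : IState n k}
    (p : QPath (Gamma n k) x y) (q : QPath (Gamma n k) y' z) (h : y ≠ y') :
    GammaAlgebra.ofPath p * GammaAlgebra.ofPath q = 0 := by
  rw [GammaAlgebra.ofPath, GammaAlgebra.ofPath, ← map_mul, ofPath_mul_ofPath_of_ne _ _ _ h,
    map_zero]

theorem GammaAlgebra.u_mul_ofPath {n k : ℕ} {x y : IState n k} (i : Fin n)
    (p : QPath (Gamma n k) x y) :
    GammaAlgebra.u i * GammaAlgebra.ofPath p
      = GammaAlgebra.ofPath (uLoop x i) * GammaAlgebra.ofPath p := by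
  rw [GammaAlgebra.u, Finset.sum_mul, Finset.sum_eq_single x]
  · exact fun b _ hb => GammaAlgebra.ofPath_mul_of_ne _ _ hb
  · simp

theorem GammaAlgebra.ofPath_mul_u {n k : ℕ} {x y : IState n k} (i : Fin n)
    (p : QPath (Gamma n k) x y) :
    GammaAlgebra.ofPath p * GammaAlgebra.u i
      = GammaAlgebra.ofPath p * GammaAlgebra.ofPath (uLoop y i) := by
  rw [GammaAlgebra.u, Finset.mul_sum, Finset.sum_eq_single y]
  · exact fun b _ hb => GammaAlgebra.ofPath_mul_of_ne _ _ hb.symm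
  · simp

theorem GammaAlgebra.commute_u_arrow {n k : ℕ} {x y : IState n k} (i : Fin n)
    (e : (Gamma n k).Hom x y) :
    GammaAlgebra.ofPath (arrowPath (Gamma n k) e) * GammaAlgebra.u i
      = GammaAlgebra.u i * GammaAlgebra.ofPath (arrowPath (Gamma n k) e) := by
  rw [GammaAlgebra.u_mul_ofPath, GammaAlgebra.ofPath_mul_u, GammaAlgebra.ofPath_mul,
    GammaAlgebra.ofPath_mul]
  refine toQuiv_eq (GammaRel.mk _ _ ?_)
  obtain ⟨l, hl⟩ := e
  cases l with
  | R j => exact WordRel.central_R j i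
  | L j => exact WordRel.central_L j i
  | U j => exact WordRel.central_U j i

theorem GammaAlgebra.commute_u_ofPath {n k : ℕ} {x y : IState n k} (i : Fin n)
    (p : QPath (Gamma n k) x y) :
    GammaAlgebra.ofPath p * GammaAlgebra.u i = GammaAlgebra.u i * GammaAlgebra.ofPath p := by
  let _ : Quiver (IState n k) := Gamma n k
  induction p with
  | nil =>
    rw [GammaAlgebra.u_mul_ofPath, GammaAlgebra.ofPath_mul_u, GammaAlgebra.ofPath_mul,
      GammaAlgebra.ofPath_mul, Quiver.Path.nil_comp, Quiver.Path.comp_nil]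
  | cons p e ih =>
    have h : GammaAlgebra.ofPath (n := n) (k := k) (Quiver.Path.cons p e)
        = GammaAlgebra.ofPath p * GammaAlgebra.ofPath (arrowPath (Gamma n k) e) := by
      rw [GammaAlgebra.ofPath_mul]; rfl
    rw [h, mul_assoc, GammaAlgebra.commute_u_arrow, ← mul_assoc, ih, mul_assoc]

theorem GammaAlgebra.u_mem_center {n k : ℕ} (i : Fin n) :
    (GammaAlgebra.u i : GammaAlgebra n k) ∈ Subalgebra.center (ZMod 2) (GammaAlgebra n k) := by
  rw [Subalgebra.mem_center_iff]
  intro a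
  obtain ⟨a, rfl⟩ := toQuiv_surjective a
  induction a using path_induction with
  | h0 => simp
  | hadd a b ha hb => rw [map_add, add_mul, mul_add, ha, hb]
  | hp c x y p =>
    have := GammaAlgebra.commute_u_ofPath i p
    rw [GammaAlgebra.ofPath] at this
    rw [map_smul, smul_mul_assoc, mul_smul_comm, this]

/-- The ring homomorphism from `𝔽₂[U_1, …, U_n]` to the center of the quiver algebra which sends
`U_i` to the sum of the loops with label `U_i`. -/
def GammaAlgebra.polyHom (n k : ℕ) :
    UPoly n →ₐ[ZMod 2] Subalgebra.center (ZMod 2) (GammaAlgebra n k) :=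
  MvPolynomial.aeval fun i => ⟨GammaAlgebra.u i, GammaAlgebra.u_mem_center i⟩

/-- The quiver algebra as a (central) algebra over `𝔽₂[U_1, …, U_n]`. -/
instance GammaAlgebra.algebraPoly (n k : ℕ) : Algebra (UPoly n) (GammaAlgebra n k) :=
  ((Subalgebra.val _).comp (GammaAlgebra.polyHom n k)).toRingHom.toAlgebra' fun p a =>
    ((Subalgebra.mem_center_iff.1 (GammaAlgebra.polyHom n k p).2) a).symm

/-- The structure of the quiver algebra as an algebra over `𝔽₂[U_1, …, U_n]^{V(n,k)}`. -/
def GammaAlgebra.baseHom (n k : ℕ) : (IState n k → UPoly n) →+* GammaAlgebra n k :=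
  idempotentRingHom (UPoly n) _ completeOrthogonalIdempotents_toQuiv

/-! ### The paths `γ_{x,y}` -/

/-- The word `R_{l+1}, …, R_m`. -/
def rWord {n : ℕ} (l m : Fin (n + 1)) : List (Label n) :=
  ((List.finRange n).filter fun i => l ≤ i.castSucc ∧ i.succ ≤ m).map Label.R

/-- The word `L_l, …, L_{m+1}`. -/
def lWord {n : ℕ} (l m : Fin (n + 1)) : List (Label n) :=
  (((List.finRange n).filter fun i => m ≤ i.castSucc ∧ i.succ ≤ l).map Label.L).reverse

/-- `IsGammaPath γ` says that `γ` is the path `γ_{x,y}`.  It is empty if `x = y`.  If `x_a < y_a` for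
some `a`, take the largest such `a`, move this dot to `y_a` by `R`-arrows, and continue with
`γ_{x',y}`.  If `y_a ≤ x_a` for all `a`, with some inequality strict, take the smallest `a` with
`y_a < x_a`, move this dot to `y_a` by `L`-arrows, and continue with `γ_{x',y}`. -/
inductive IsGammaPath {n k : ℕ} : {x y : IState n k} → QPath (Gamma n k) x y → Prop
  | nil (x : IState n k) : IsGammaPath (@Quiver.Path.nil _ (Gamma n k) x)
  | right {x x' y : IState n k} (a : Fin k) (ha : x.dot a < y.dot a)
      (hmax : ∀ b, x.dot b < y.dot b → b ≤ a)
      (hx' : x'.1 = insert (y.dot a) (x.1 \ {x.dot a}))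
      (p : QPath (Gamma n k) x x') (hp : word p = rWord (x.dot a) (y.dot a))
      (q : QPath (Gamma n k) x' y) (hq : IsGammaPath q) :
      IsGammaPath (@Quiver.Path.comp _ (Gamma n k) _ _ _ p q)
  | left {x x' y : IState n k} (hle : ∀ b, y.dot b ≤ x.dot b)
      (a : Fin k) (ha : y.dot a < x.dot a)
      (hmin : ∀ b, y.dot b < x.dot b → a ≤ b)
      (hx' : x'.1 = insert (y.dot a) (x.1 \ {x.dot a}))
      (p : QPath (Gamma n k) x x') (hp : word p = lWord (x.dot a) (y.dot a))
      (q : QPath (Gamma n k) x' y) (hq : IsGammaPath q) :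
      IsGammaPath (@Quiver.Path.comp _ (Gamma n k) _ _ _ p q)

end OSz

end

/-! The homomorphism `F` is forced: an `R`- or `L`-arrow goes to `f x y`, and a loop labelled `U i`
goes to `U_i • f x x`. Every relation of the quiver involves words of at most two letters, and for
these the monomials in `B0` are `1` or `U_i`, exactly as needed (`B0.val_eq_of_wordRel`). The
substance is the inverse: the classes `gammaElt x y` of the paths γ must obey the composition law of
the `f x y` (`gammaElt_mul_gammaElt`).

The word of γ has a closed form, `blockProd`. Each dot contributes one block of letters from its
position in `x` to its position in `y`; the `R`-blocks come by decreasing dot number, then the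
`L`-blocks by increasing number (`IsGammaPath.prod_word`). If `letter l` is the sum of all arrows
labelled `l`, the class of a path is its starting vertex times the product of the letters of its
word, and `R`- and `L`-letters whose indices differ by more than one commute.

Let an arrow `R i` from `x` to `x'` move dot `a`. If dot `a` of `z` lies further right than in `x`,
then `R i` opens block `a` of γ from `x` to `z`, and it commutes with the blocks before it because
the dots stay in order. So the arrow times γ from `x'` to `z` is γ from `x` to `z`. Otherwise the
block product from `x'` to `z` begins with `L i`, and `R_i L_i = U_i` produces a factor `U_i`. The
sign of the relative weight at `i` distinguishes the two cases, so the factor is the weight monomial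
(`arrow_R_mul_gammaElt`, and symmetrically `arrow_L_mul_gammaElt`). The general law follows by
splitting first letters off γ and using the cocycle identity `weightMonomial_cocycle`. The two
homomorphisms are inverse to each other because they are so on generators. -/

noncomputable section

namespace OSz

universe u

/-! ### Homomorphisms out of path algebras and quiver algebras -/

section Lift

variable {𝕜 : Type*} [CommRing 𝕜] {V : Type u} {Q : Quiver.{0} V} {A : Type*} [Ring A]

/-- The product of the values of the arrows along a path. -/
def pathVal (e : V → A) (φ : ∀ {x y : V}, Q.Hom x y → A) {x : V} : {y : V} → QPath Q x y → A
  | _, .nil => e x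
  | _, .cons p a => pathVal e φ p * φ a

/-- The values `e` at vertices and `φ` at arrows define a representation of the quiver. -/
structure IsRep (e : V → A) (φ : ∀ {x y : V}, Q.Hom x y → A) : Prop where
  left : ∀ {x y : V} (a : Q.Hom x y), e x * φ a = φ a
  right : ∀ {x y : V} (a : Q.Hom x y), φ a * e y = φ a

variable {e : V → A} {φ : ∀ {x y : V}, Q.Hom x y → A}

theorem pathVal_arrowPath (h : IsRep e φ) {x y : V} (a : Q.Hom x y) :
    pathVal e φ (arrowPath Q a) = φ a := h.left a

variable [Fintype V]

theorem pathVal_mul_idem (he : CompleteOrthogonalIdempotents e) (h : IsRep e φ) {x y : V}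
    (p : QPath Q x y) : pathVal e φ p * e y = pathVal e φ p := by
  cases p with
  | nil => exact he.idem x
  | cons p a => rw [pathVal, mul_assoc, h.right]

theorem idem_mul_pathVal (he : CompleteOrthogonalIdempotents e) {x y : V}
    (p : QPath Q x y) : e x * pathVal e φ p = pathVal e φ p := by
  let _ : Quiver V := Q
  induction p with
  | nil => exact he.idem x
  | cons p a ih => rw [pathVal, ← mul_assoc, ih]

theorem pathVal_comp (he : CompleteOrthogonalIdempotents e) (h : IsRep e φ) {x y z : V}
    (p : QPath Q x y) (q : QPath Q y z) :
    pathVal e φ (p.comp q) = pathVal e φ p * pathVal e φ q := by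
  let _ : Quiver V := Q
  induction q with
  | nil => exact (pathVal_mul_idem he h p).symm
  | cons q a ih => rw [Quiver.Path.comp_cons, pathVal, pathVal, ih, mul_assoc]

variable [Algebra 𝕜 A]

/-- The algebra homomorphism from the path algebra given by a representation of the quiver. -/
def pathLift (he : CompleteOrthogonalIdempotents e) (h : IsRep e φ) : PathAlgebra 𝕜 Q →ₐ[𝕜] A :=
  AlgHom.ofLinearMap (extendLin fun p => pathVal e φ p.2.2)
    (by
      rw [one_eq_sum_idem, map_sum, ← he.complete]
      exact Finset.sum_congr rfl fun v _ => extendLin_ofPath _ _)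
    (by
      intro a b
      induction a using path_induction with
      | h0 => simp only [zero_mul, map_zero]
      | hadd a a' h h' => simp only [add_mul, map_add, h, h']
      | hp s x y p =>
      induction b using path_induction with
      | h0 => simp only [mul_zero, map_zero]
      | hadd a a' h h' => simp only [mul_add, map_add, h, h']
      | hp t x' y' q =>
      simp only [smul_mul_assoc, mul_smul_comm, map_smul, extendLin_ofPath]
      congr 2
      by_cases hy : y = x'
      · subst hy
        rw [ofPath_mul_ofPath, extendLin_ofPath]
        exact pathVal_comp he h p q
      · rw [ofPath_mul_ofPath_of_ne _ _ _ hy, map_zero, ← pathVal_mul_idem he h p,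
          ← idem_mul_pathVal he q, mul_assoc, ← mul_assoc (e y), he.ortho hy, zero_mul, mul_zero])

theorem pathLift_ofPath (he : CompleteOrthogonalIdempotents e) (h : IsRep e φ) {x y : V}
    (p : QPath Q x y) : pathLift he h (ofPath 𝕜 p) = pathVal e φ p :=
  extendLin_ofPath _ p

theorem pathLift_idem (he : CompleteOrthogonalIdempotents e) (h : IsRep e φ) (x : V) :
    pathLift he h (idem 𝕜 Q x) = e x :=
  pathLift_ofPath he h _

/-- Ring homomorphisms out of a quiver algebra. -/
def quivLift {R : Set (PathAlgebra 𝕜 Q)} (f : PathAlgebra 𝕜 Q →ₐ[𝕜] A) (hf : ∀ r ∈ R, f r = 0) :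
    QuiverAlgebra R →ₐ[𝕜] A :=
  { (TwoSidedIdeal.span R).ringCon.lift f.toRingHom (by
      intro a b hab
      have h1 : TwoSidedIdeal.span R ≤ TwoSidedIdeal.ker f.toRingHom :=
        TwoSidedIdeal.span_le.2 fun r hr => (TwoSidedIdeal.mem_ker _).2 (hf r hr)
      have h2 := (TwoSidedIdeal.mem_ker _).1 (h1 ((TwoSidedIdeal.rel_iff _ _ _).1 hab))
      rw [map_sub, sub_eq_zero] at h2
      exact h2) with
    commutes' := f.commutes }

end Lift

section Ext

variable {𝕜 : Type*} [CommRing 𝕜] {V : Type u} {Q : Quiver.{0} V} {A : Type*} [Ring A]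
  [Fintype V] [Algebra 𝕜 A] {R : Set (PathAlgebra 𝕜 Q)}

theorem toQuiv_cons {x y z : V} (p : QPath Q x y) (a : Q.Hom y z) :
    toQuiv R (ofPath 𝕜 (Quiver.Path.cons p a)) =
      toQuiv R (ofPath 𝕜 p) * toQuiv R (ofPath 𝕜 (arrowPath Q a)) := by
  rw [← map_mul, ofPath_mul_ofPath]; rfl

/-- A property of the elements of a quiver algebra that is compatible with the operations holds if
it holds for the empty paths and for the arrows. -/
theorem quiv_induction {P : QuiverAlgebra R → Prop} (h0 : P 0)
    (hadd : ∀ a b, P a → P b → P (a + b)) (hsmul : ∀ (c : 𝕜) a, P a → P (c • a))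
    (hmul : ∀ a b, P a → P b → P (a * b))
    (hidem : ∀ v, P (toQuiv R (idem 𝕜 Q v)))
    (harrow : ∀ (x y : V) (a : Q.Hom x y), P (toQuiv R (ofPath 𝕜 (arrowPath Q a))))
    (a : QuiverAlgebra R) : P a := by
  obtain ⟨a, rfl⟩ := toQuiv_surjective a
  induction a using path_induction with
  | h0 => simpa using h0
  | hadd a b ha hb => rw [map_add]; exact hadd _ _ ha hb
  | hp c x y p =>
    rw [map_smul]
    refine hsmul _ _ ?_
    let _ : Quiver V := Q
    induction p with
    | nil => exact hidem x
    | cons p a ih => rw [toQuiv_cons]; exact hmul _ _ ih (harrow _ _ a)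

end Ext

variable {n k : ℕ}

/-! ### The dots of an I-state -/

namespace IState

theorem dot_strictMono (x : IState n k) : StrictMono x.dot := (x.1.orderEmbOfFin x.2).strictMono

theorem dot_mem (x : IState n k) (a : Fin k) : x.dot a ∈ x.1 := Finset.orderEmbOfFin_mem _ _ _

theorem mem_iff (x : IState n k) (s : Fin (n + 1)) : s ∈ x.1 ↔ ∃ a, x.dot a = s := by
  have h := Finset.range_orderEmbOfFin x.1 x.2
  rw [← Finset.mem_coe, ← h]; rfl

theorem ext_dot {x y : IState n k} (h : ∀ a, x.dot a = y.dot a) : x = y := by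
  apply Subtype.ext
  ext s
  rw [mem_iff, mem_iff]
  simp only [h]

/-- The position `t` lies strictly between the neighbours of the dot number `a`. -/
structure Fits (x : IState n k) (a : Fin k) (t : Fin (n + 1)) : Prop where
  below : ∀ b < a, x.dot b < t
  above : ∀ b > a, t < x.dot b

theorem Fits.strictMono {x : IState n k} {a : Fin k} {t : Fin (n + 1)} (h : x.Fits a t) :
    StrictMono (Function.update x.dot a t) := by
  intro c d hcd
  have h1 := h.below
  have h2 := h.above
  have h3 := x.dot_strictMono hcd
  simp only [Function.update_apply]
  grind

/-- A finite set has only one increasing enumeration, and the updated one is increasing with values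
in `y`. Hence a move to a fitting position keeps the numbers of all dots. -/
theorem Fits.dot_eq {x y : IState n k} {a : Fin k} {t : Fin (n + 1)} (h : x.Fits a t)
    (hy : y.1 = insert t (x.1 \ {x.dot a})) : y.dot = Function.update x.dot a t := by
  refine (Finset.orderEmbOfFin_unique y.2 (fun b => ?_) h.strictMono).symm
  rw [hy, Finset.mem_insert, Finset.mem_sdiff, Finset.mem_singleton]
  by_cases hb : b = a
  · subst hb; simp
  · rw [Function.update_of_ne hb]
    exact Or.inr ⟨x.dot_mem b, fun h' => hb (x.dot_strictMono.injective h')⟩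

theorem Fits.notMem {x : IState n k} {a : Fin k} {t : Fin (n + 1)} (h : x.Fits a t) :
    t ∉ x.1 \ {x.dot a} := by
  rw [Finset.mem_sdiff, Finset.mem_singleton, mem_iff]
  rintro ⟨⟨b, rfl⟩, hb⟩
  rcases lt_trichotomy b a with hba | rfl | hba
  · exact lt_irrefl _ (h.below b hba)
  · exact hb rfl
  · exact lt_irrefl _ (h.above b hba)

theorem Fits.exists_move {x : IState n k} {a : Fin k} {t : Fin (n + 1)} (h : x.Fits a t) :
    ∃ y : IState n k, y.1 = insert t (x.1 \ {x.dot a}) := by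
  refine ⟨⟨insert t (x.1 \ {x.dot a}), ?_⟩, rfl⟩
  have hk : 0 < k := a.pos
  rw [Finset.card_insert_of_notMem h.notMem, Finset.card_sdiff_of_subset (by simpa using x.dot_mem a),
    x.2, Finset.card_singleton]
  omega

theorem fits_of_R {x : IState n k} {i : Fin n} (hi : i.succ ∉ x.1) {a : Fin k}
    (ha : x.dot a = i.castSucc) : x.Fits a i.succ where
  below b hb := (ha ▸ x.dot_strictMono hb).trans i.castSucc_lt_succ
  above b hb := by
    have h1 : i.castSucc < x.dot b := ha ▸ x.dot_strictMono hb
    refine lt_of_le_of_ne (Fin.castSucc_lt_iff_succ_le.1 h1) fun h => hi (h ▸ x.dot_mem b)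

theorem fits_of_L {x : IState n k} {i : Fin n} (hi : i.castSucc ∉ x.1) {a : Fin k}
    (ha : x.dot a = i.succ) : x.Fits a i.castSucc where
  below b hb := by
    have h1 : x.dot b < i.succ := ha ▸ x.dot_strictMono hb
    exact lt_of_le_of_ne (Fin.le_castSucc_iff.2 h1) fun h => hi (h ▸ x.dot_mem b)
  above b hb := i.castSucc_lt_succ.trans (ha ▸ x.dot_strictMono hb)

end IState

/-! ### Arrows in terms of numbered dots. -/

theorem IsArrow.dots_R {x y : IState n k} {i : Fin n} (h : IsArrow (.R i) x y) :
    ∃ a, x.dot a = i.castSucc ∧ x.Fits a i.succ ∧ y.dot = Function.update x.dot a i.succ := by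
  obtain ⟨h1, h2, h3⟩ := h
  obtain ⟨a, ha⟩ := (x.mem_iff _).1 h1
  have hf := IState.fits_of_R h2 ha
  exact ⟨a, ha, hf, hf.dot_eq (by rw [h3, ha])⟩

theorem IsArrow.dots_L {x y : IState n k} {i : Fin n} (h : IsArrow (.L i) x y) :
    ∃ a, x.dot a = i.succ ∧ x.Fits a i.castSucc ∧
      y.dot = Function.update x.dot a i.castSucc := by
  obtain ⟨h1, h2, h3⟩ := h
  obtain ⟨a, ha⟩ := (x.mem_iff _).1 h1
  have hf := IState.fits_of_L h2 ha
  exact ⟨a, ha, hf, hf.dot_eq (by rw [h3, ha])⟩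

theorem isArrow_R_of_dots {x y : IState n k} {i : Fin n} {a : Fin k} (ha : x.dot a = i.castSucc)
    (hf : x.Fits a i.succ) (hy : y.1 = insert i.succ (x.1 \ {x.dot a})) : IsArrow (.R i) x y := by
  refine ⟨ha ▸ x.dot_mem a, fun h => hf.notMem ?_, by rw [hy, ha]⟩
  rw [Finset.mem_sdiff, Finset.mem_singleton, ha]
  exact ⟨h, i.castSucc_lt_succ.ne'⟩

theorem isArrow_L_of_dots {x y : IState n k} {i : Fin n} {a : Fin k} (ha : x.dot a = i.succ)
    (hf : x.Fits a i.castSucc) (hy : y.1 = insert i.castSucc (x.1 \ {x.dot a})) :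
    IsArrow (.L i) x y := by
  refine ⟨ha ▸ x.dot_mem a, fun h => hf.notMem ?_, by rw [hy, ha]⟩
  rw [Finset.mem_sdiff, Finset.mem_singleton, ha]
  exact ⟨h, i.castSucc_lt_succ.ne⟩

/-- The quiver is deterministic. This is why a path is determined by its word, and why a vertex
picks at most one arrow out of a sum of equally labelled arrows. -/
theorem IsArrow.eq_right {l : Label n} {x y z : IState n k} (hy : IsArrow l x y)
    (hz : IsArrow l x z) : y = z := by
  cases l with
  | R i => exact Subtype.ext (hy.2.2.trans hz.2.2.symm)
  | L i => exact Subtype.ext (hy.2.2.trans hz.2.2.symm)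
  | U i => exact Eq.trans hy (Eq.symm hz)

theorem IsArrow.symm_R {i : Fin n} {x y : IState n k} (h : IsArrow (.R i) x y) :
    IsArrow (.L i) y x := by
  obtain ⟨h1, h2, h3⟩ := h
  have hne := i.castSucc_lt_succ.ne
  refine ⟨by simp [h3], by simp [h3, hne], ?_⟩
  ext s
  simp only [h3, Finset.mem_insert, Finset.mem_sdiff, Finset.mem_singleton]
  grind

theorem IsArrow.symm_L {i : Fin n} {x y : IState n k} (h : IsArrow (.L i) x y) :
    IsArrow (.R i) y x := by
  obtain ⟨h1, h2, h3⟩ := h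
  have hne := i.castSucc_lt_succ.ne'
  refine ⟨by simp [h3], by simp [h3, hne], ?_⟩
  ext s
  simp only [h3, Finset.mem_insert, Finset.mem_sdiff, Finset.mem_singleton]
  grind

/-! ### Relative weights -/

theorem relWeight_add (x y z : IState n k) (i : Fin n) :
    relWeight x y i + relWeight y z i = relWeight x z i := by
  simp only [relWeight]; ring

theorem relWeight_self (x : IState n k) (i : Fin n) : relWeight x x i = 0 := by
  simp [relWeight]

theorem relWeight_neg (x y : IState n k) (i : Fin n) : relWeight y x i = -relWeight x y i := by
  simp only [relWeight]; ring

/-- Both states arise from `x.1 \ {i.castSucc}` by adding one point, and the two added points are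
separated by the threshold `j.succ` only for `j = i`. -/
theorem IsArrow.relWeight_R {i : Fin n} {x y : IState n k} (h : IsArrow (.R i) x y) (j : Fin n) :
    relWeight x y j = if j = i then 1 else 0 := by
  obtain ⟨h1, h2, h3⟩ := h
  have e1 : x.1 = insert i.castSucc (x.1 \ {i.castSucc}) := by
    ext s; simp only [Finset.mem_insert, Finset.mem_sdiff, Finset.mem_singleton]; grind
  have e2 : i.succ ∉ x.1 \ {i.castSucc} := fun h => h2 (Finset.mem_sdiff.1 h).1
  have e3 : i.castSucc ∉ x.1 \ {i.castSucc} := by simp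
  rw [relWeight, h3, Finset.card_filter, Finset.sum_insert e2]
  conv_lhs => rw [e1]
  rw [Finset.card_filter, Finset.sum_insert e3]
  simp only [Finset.insert_sdiff_of_mem, Finset.mem_singleton, Finset.sdiff_idem]
  simp only [Fin.le_def, Fin.val_succ, Fin.val_castSucc, Fin.ext_iff]
  push_cast
  split_ifs <;> omega

theorem IsArrow.relWeight_L {i : Fin n} {x y : IState n k} (h : IsArrow (.L i) x y) (j : Fin n) :
    relWeight x y j = if j = i then -1 else 0 := by
  rw [relWeight_neg, h.symm_L.relWeight_R]
  split_ifs <;> rfl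

theorem card_filter_dot (x : IState n k) (t : Fin (n + 1)) :
    (x.1.filter (t ≤ ·)).card = (Finset.univ.filter fun a => t ≤ x.dot a).card := by
  rw [← Finset.card_image_of_injective _ x.dot_strictMono.injective]
  congr 1
  ext s
  simp only [Finset.mem_filter, Finset.mem_image, Finset.mem_univ, true_and, IState.mem_iff]
  grind

/-- Dots are numbered increasingly, so only those with number above `a` can reach `t`. -/
theorem card_filter_le_of_dot_lt {z : IState n k} {a : Fin k} {t : Fin (n + 1)} (h : z.dot a < t) :
    (z.1.filter (t ≤ ·)).card ≤ (Finset.Ioi a).card := by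
  rw [card_filter_dot]
  refine Finset.card_le_card fun b hb => ?_
  rw [Finset.mem_filter] at hb
  exact Finset.mem_Ioi.2 (z.dot_strictMono.lt_iff_lt.1 (h.trans_le hb.2))

theorem le_card_filter_of_le_dot {z : IState n k} {a : Fin k} {t : Fin (n + 1)} (h : t ≤ z.dot a) :
    (Finset.Ioi a).card + 1 ≤ (z.1.filter (t ≤ ·)).card := by
  rw [card_filter_dot, ← Finset.card_insert_of_notMem (s := Finset.Ioi a) (a := a) (by simp)]
  refine Finset.card_le_card fun b hb => ?_
  rw [Finset.mem_filter]
  have : a ≤ b := by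
    rcases Finset.mem_insert.1 hb with rfl | hb
    · exact le_rfl
    · exact (Finset.mem_Ioi.1 hb).le
  exact ⟨Finset.mem_univ _, h.trans (z.dot_strictMono.monotone this)⟩

/-- Only the dots numbered above `a` can lie at or beyond `i.succ` in `x`, whereas in `z` all of
these and dot `a` itself do. This turns a comparison of single dots into a sign of the relative
weight. -/
theorem relWeight_pos_of_dot_lt {x z : IState n k} {i : Fin n} {a : Fin k}
    (hx : x.dot a = i.castSucc) (h : x.dot a < z.dot a) : 0 < relWeight x z i := by
  have h1 := card_filter_le_of_dot_lt (z := x) (a := a) (t := i.succ) (hx ▸ i.castSucc_lt_succ)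
  have h2 := le_card_filter_of_le_dot (z := z) (a := a) (t := i.succ)
    (Fin.castSucc_lt_iff_succ_le.1 (hx ▸ h))
  rw [relWeight]; omega

theorem relWeight_neg_of_dot_lt {x z : IState n k} {i : Fin n} {a : Fin k}
    (hx : x.dot a = i.succ) (h : z.dot a < x.dot a) : relWeight x z i < 0 := by
  have h1 := le_card_filter_of_le_dot (z := x) (a := a) (t := i.succ) hx.ge
  have h2 := card_filter_le_of_dot_lt (z := z) (a := a) (t := i.succ) (hx ▸ h)
  rw [relWeight]; omega

/-! ### Weight monomials -/

theorem weightMonomial_eq_one {x y z : IState n k} (h : ∀ i, weightDefect x y z i = 0) :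
    weightMonomial x y z = 1 :=
  Finset.prod_eq_one fun i _ => by rw [h]; rfl

theorem weightMonomial_eq_X {x y z : IState n k} (i : Fin n)
    (h : ∀ j, weightDefect x y z j = if j = i then 2 else 0) :
    weightMonomial x y z = MvPolynomial.X i := by
  rw [weightMonomial, Finset.prod_eq_single i]
  · simp [h]
  · intro j _ hj; simp [h, hj]
  · simp

theorem weightMonomial_self_left (x z : IState n k) : weightMonomial x x z = 1 :=
  weightMonomial_eq_one fun i => by simp [weightDefect, relWeight_self]

theorem weightMonomial_self_right (x y : IState n k) : weightMonomial x y y = 1 :=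
  weightMonomial_eq_one fun i => by simp [weightDefect, relWeight_self]

/-- The defect is the coboundary of `|v|`, so it satisfies the identity that associativity of the
product of the `f x y` requires. -/
theorem weightMonomial_cocycle (x y z w : IState n k) :
    weightMonomial x y w * weightMonomial y z w = weightMonomial x y z * weightMonomial x z w := by
  simp only [weightMonomial, ← Finset.prod_mul_distrib, ← pow_add]
  refine Finset.prod_congr rfl fun i _ => ?_
  obtain ⟨h1, h1'⟩ := weightDefect_nonneg_even x y w i
  obtain ⟨h2, h2'⟩ := weightDefect_nonneg_even y z w i
  obtain ⟨h3, h3'⟩ := weightDefect_nonneg_even x y z i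
  obtain ⟨h4, h4'⟩ := weightDefect_nonneg_even x z w i
  have : weightDefect x y w i + weightDefect y z w i =
      weightDefect x y z i + weightDefect x z w i := by
    simp only [weightDefect]; ring
  rw [Int.even_iff] at h1' h2' h3' h4'
  -- All four defects are even and nonnegative, so halving and `toNat` lose nothing.
  congr 1
  omega

/-- With `v = relWeight x z i`, the exponent of `U_i` is `(|v - 1| - |v| + 1) / 2`, which is `0` for
`v > 0` and `1` for `v ≤ 0`; the other exponents vanish. -/
theorem weightMonomial_R_of_lt {x x' z : IState n k} {i : Fin n} (h : IsArrow (.R i) x x')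
    (hz : 0 < relWeight x z i) : weightMonomial x x' z = 1 := by
  refine weightMonomial_eq_one fun j => ?_
  have h1 := relWeight_add x x' z j
  rw [weightDefect, ← h1, h.relWeight_R]
  rw [h.relWeight_R] at h1
  split_ifs at h1 ⊢ with hj
  · subst hj; grind
  · simp

theorem weightMonomial_L_of_lt {x x' z : IState n k} {i : Fin n} (h : IsArrow (.L i) x x')
    (hz : relWeight x z i < 0) : weightMonomial x x' z = 1 := by
  refine weightMonomial_eq_one fun j => ?_
  have h1 := relWeight_add x x' z j
  rw [weightDefect, ← h1, h.relWeight_L]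
  rw [h.relWeight_L] at h1
  split_ifs at h1 ⊢ with hj
  · subst hj; grind
  · simp

/-- The relative weight from `x'` is one less than that from `x`, so the hypothesis is the
complementary case `relWeight x z i ≤ 0`. -/
theorem weightMonomial_R_of_le {x x' z : IState n k} {i : Fin n} (h : IsArrow (.R i) x x')
    (hz : relWeight x' z i < 0) : weightMonomial x x' z = MvPolynomial.X i := by
  refine weightMonomial_eq_X i fun j => ?_
  rw [weightDefect, ← relWeight_add x x' z j, h.relWeight_R]
  split_ifs with hj
  · subst hj; grind
  · simp

theorem weightMonomial_L_of_le {x x' z : IState n k} {i : Fin n} (h : IsArrow (.L i) x x')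
    (hz : 0 < relWeight x' z i) : weightMonomial x x' z = MvPolynomial.X i := by
  refine weightMonomial_eq_X i fun j => ?_
  rw [weightDefect, ← relWeight_add x x' z j, h.relWeight_L]
  split_ifs with hj
  · subst hj; grind
  · simp

/-! ### Moving towards an I-state -/

/-- The position `t` between `x.dot a` and `y.dot a` is free if `a` is the largest index with
`x.dot a < y.dot a`. -/
theorem IState.fits_right {x y : IState n k} {a : Fin k} {t : Fin (n + 1)}
    (hmax : ∀ b, x.dot b < y.dot b → b ≤ a) (h1 : x.dot a ≤ t) (h2 : t ≤ y.dot a) :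
    x.Fits a t where
  below _ hb := (x.dot_strictMono hb).trans_le h1
  above b hb :=
    h2.trans_lt ((y.dot_strictMono hb).trans_le (not_lt.1 fun h => (hmax b h).not_gt hb))

theorem IState.fits_left {x y : IState n k} {a : Fin k} {t : Fin (n + 1)}
    (hmin : ∀ b, y.dot b < x.dot b → a ≤ b) (h1 : y.dot a ≤ t) (h2 : t ≤ x.dot a) :
    x.Fits a t where
  below b hb :=
    ((not_lt.1 fun h => (hmin b h).not_gt hb : x.dot b ≤ y.dot b).trans_lt
      (y.dot_strictMono hb)).trans_le h1
  above _ hb := h2.trans_lt (x.dot_strictMono hb)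

theorem exists_max_fin {p : Fin k → Prop} (h : ∃ a, p a) :
    ∃ a, p a ∧ ∀ b, p b → b ≤ a := by
  classical
  obtain ⟨a, ha⟩ := h
  obtain ⟨b, hb, hb'⟩ := (Finset.univ.filter p).exists_max_image id ⟨a, by simpa using ha⟩
  exact ⟨b, by simpa using hb, fun c hc => hb' c (by simpa using hc)⟩

theorem exists_min_fin {p : Fin k → Prop} (h : ∃ a, p a) : ∃ a, p a ∧ ∀ b, p b → a ≤ b := by
  classical
  obtain ⟨a, ha⟩ := h
  obtain ⟨b, hb, hb'⟩ := (Finset.univ.filter p).exists_min_image id ⟨a, by simpa using ha⟩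
  exact ⟨b, by simpa using hb, fun c hc => hb' c (by simpa using hc)⟩

/-- The total distance of the dots of two I-states. -/
def dotDist (x y : IState n k) : ℕ := ∑ a, Nat.dist (x.dot a) (y.dot a)

theorem dotDist_lt {x x' y : IState n k} {a : Fin k} {t : Fin (n + 1)}
    (hx' : x'.dot = Function.update x.dot a t)
    (h : Nat.dist t (y.dot a) < Nat.dist (x.dot a) (y.dot a)) : dotDist x' y < dotDist x y := by
  refine Finset.sum_lt_sum (fun b _ => ?_) ⟨a, Finset.mem_univ a, by simpa [hx'] using h⟩
  rw [hx', Function.update_apply]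
  split_ifs with hb
  · subst hb; exact h.le
  · exact le_rfl

/-- A property of `x` holds if it holds for `y` and is preserved by arrows that lead away from
`y`. -/
theorem IState.induction_towards (y : IState n k) {P : IState n k → Prop} (refl : P y)
    (right : ∀ x x' i a, IsArrow (.R i) x x' → x.dot a = i.castSucc → x.dot a < y.dot a →
      P x' → P x)
    (left : ∀ x x' i a, IsArrow (.L i) x x' → x.dot a = i.succ → y.dot a < x.dot a →
      P x' → P x) (x : IState n k) : P x := by
  induction hd : dotDist x y using Nat.strong_induction_on generalizing x with
  | _ d ih =>
  subst hd
  by_cases h : ∃ a, x.dot a < y.dot a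
  · obtain ⟨a, ha, hmax⟩ := exists_max_fin h
    -- Dot `a` lies below another position, so it is not at the last one and some `R`-label starts
    -- there.
    obtain ⟨i, hi⟩ := Fin.exists_castSucc_eq.2 (ne_of_lt (ha.trans_le (Fin.le_last _)))
    have hle : i.succ ≤ y.dot a := Fin.castSucc_lt_iff_succ_le.1 (hi ▸ ha)
    have hf : x.Fits a i.succ := IState.fits_right hmax (hi ▸ i.castSucc_lt_succ.le) hle
    obtain ⟨x', hx'⟩ := hf.exists_move
    refine right x x' i a (isArrow_R_of_dots hi.symm hf hx') hi.symm ha (ih _ ?_ x' rfl)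
    refine dotDist_lt (hf.dot_eq hx') ?_
    have h1 : (i.succ : ℕ) ≤ y.dot a := hle
    rw [← hi]
    simp only [Nat.dist, Fin.val_succ, Fin.val_castSucc] at h1 ⊢
    omega
  by_cases h' : ∃ a, y.dot a < x.dot a
  · obtain ⟨a, ha, hmin⟩ := exists_min_fin h'
    obtain ⟨i, hi⟩ := Fin.exists_succ_eq.2 (ne_of_gt ((Fin.zero_le _).trans_lt ha))
    have hle : y.dot a ≤ i.castSucc := Fin.le_castSucc_iff.2 (hi ▸ ha)
    have hf : x.Fits a i.castSucc := IState.fits_left hmin hle (hi ▸ i.castSucc_lt_succ.le)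
    obtain ⟨x', hx'⟩ := hf.exists_move
    refine left x x' i a (isArrow_L_of_dots hi.symm hf hx') hi.symm ha (ih _ ?_ x' rfl)
    refine dotDist_lt (hf.dot_eq hx') ?_
    have h1 : (y.dot a : ℕ) ≤ i.castSucc := hle
    rw [← hi]
    simp only [Nat.dist, Fin.val_succ, Fin.val_castSucc] at h1 ⊢
    omega
  push Not at h h'
  rwa [show x = y from IState.ext_dot fun a => le_antisymm (h' a) (h a)]

/-! ### Words -/

theorem mem_rWord {l m : Fin (n + 1)} {c : Label n} (h : c ∈ rWord l m) :
    ∃ i, c = .R i ∧ l ≤ i.castSucc ∧ i.succ ≤ m := by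
  simp only [rWord, List.mem_map, List.mem_filter, decide_eq_true_eq] at h
  obtain ⟨i, ⟨-, h1, h2⟩, rfl⟩ := h
  exact ⟨i, rfl, h1, h2⟩

theorem mem_lWord {l m : Fin (n + 1)} {c : Label n} (h : c ∈ lWord l m) :
    ∃ i, c = .L i ∧ m ≤ i.castSucc ∧ i.succ ≤ l := by
  simp only [lWord, List.mem_reverse, List.mem_map, List.mem_filter, decide_eq_true_eq] at h
  obtain ⟨i, ⟨-, h1, h2⟩, rfl⟩ := h
  exact ⟨i, rfl, h1, h2⟩

theorem rWord_eq_nil {l m : Fin (n + 1)} (h : m ≤ l) : rWord l m = [] := by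
  refine List.eq_nil_iff_forall_not_mem.2 fun c hc => ?_
  obtain ⟨i, -, h1, h2⟩ := mem_rWord hc
  exact ((h2.trans h).trans h1).not_gt i.castSucc_lt_succ

theorem lWord_eq_nil {l m : Fin (n + 1)} (h : l ≤ m) : lWord l m = [] := by
  refine List.eq_nil_iff_forall_not_mem.2 fun c hc => ?_
  obtain ⟨i, -, h1, h2⟩ := mem_lWord hc
  exact ((h2.trans h).trans h1).not_gt i.castSucc_lt_succ

/-- Both index lists are strictly increasing, so it is enough to compare their members. -/
theorem rWord_cons {i : Fin n} {m : Fin (n + 1)} (h : i.succ ≤ m) :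
    rWord i.castSucc m = .R i :: rWord i.succ m := by
  rw [rWord, rWord, ← List.map_cons]
  congr 1
  refine List.SortedLT.eq_of_mem_iff ((List.pairwise_lt_finRange n).filter _).sortedLT
    (List.Pairwise.cons (fun j hj => ?_) ((List.pairwise_lt_finRange n).filter _)).sortedLT fun j => ?_
  · simp only [List.mem_filter, decide_eq_true_eq, Fin.le_def, Fin.val_succ,
      Fin.val_castSucc] at hj
    exact Fin.lt_def.2 (by omega)
  · simp only [List.mem_filter, List.mem_cons, List.mem_finRange, decide_eq_true_eq, Fin.le_def,
      Fin.val_succ, Fin.val_castSucc, Fin.ext_iff, true_and] at h ⊢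
    omega

theorem lWord_cons {i : Fin n} {m : Fin (n + 1)} (h : m ≤ i.castSucc) :
    lWord i.succ m = .L i :: lWord i.castSucc m := by
  -- `lWord` reverses an increasing list, so its first letter is the last entry of that list.
  have key : ((List.finRange n).filter fun j => m ≤ j.castSucc ∧ j.succ ≤ i.succ) =
      ((List.finRange n).filter fun j => m ≤ j.castSucc ∧ j.succ ≤ i.castSucc) ++ [i] := by
    refine List.SortedLT.eq_of_mem_iff ((List.pairwise_lt_finRange n).filter _).sortedLT
      (List.Pairwise.sortedLT ?_) fun j => ?_
    · rw [List.pairwise_append]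
      refine ⟨(List.pairwise_lt_finRange n).filter _, List.pairwise_singleton _ _, fun j hj j' hj' => ?_⟩
      rw [List.mem_singleton] at hj'
      subst hj'
      simp only [List.mem_filter, decide_eq_true_eq, Fin.le_def, Fin.val_succ,
        Fin.val_castSucc] at hj
      exact Fin.lt_def.2 (by omega)
    · simp only [List.mem_filter, List.mem_append, List.mem_singleton,
        List.mem_finRange, decide_eq_true_eq, Fin.le_def,
        Fin.val_succ, Fin.val_castSucc, Fin.ext_iff, true_and] at h ⊢
      omega
  rw [lWord, lWord, key, List.map_append, List.reverse_append]
  rfl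

/-! ### The product of the blocks of a path `γ_{x,y}` -/

section Block

variable {M : Type*} [Monoid M]

/-- The factor `w` is taken out of the entry at `a` and carried to the front past the entries
preceding `a`. Irreflexivity of `r` ensures that `a` occurs only once in `l`. -/
theorem list_prod_map_eq_mul {ι : Type*} {r : ι → ι → Prop} (hr : ∀ b, ¬ r b b) {l : List ι}
    (hl : l.Pairwise r) {a : ι} (ha : a ∈ l) {f f' : ι → M} {w : M}
    (hne : ∀ b, b ≠ a → f' b = f b) (hc : ∀ b, r b a → Commute w (f b))
    (hfa : f a = w * f' a) : (l.map f).prod = w * (l.map f').prod := by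
  induction l with
  | nil => simp at ha
  | cons c l ih =>
    rw [List.pairwise_cons] at hl
    simp only [List.map_cons, List.prod_cons]
    by_cases hca : c = a
    · subst hca
      rw [hfa, mul_assoc]
      congr 3
      refine List.map_congr_left fun b hb => (hne b ?_).symm
      rintro rfl
      exact hr _ (hl.1 _ hb)
    · have ha' : a ∈ l := by
        rcases List.mem_cons.1 ha with h | h
        · exact absurd h.symm hca
        · exact h
      rw [ih hl.2 ha', hne c hca, ← mul_assoc, ← mul_assoc, (hc c (hl.1 a ha')).eq]

theorem commute_list_prod {l : List M} {w : M} (h : ∀ c ∈ l, Commute w c) :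
    Commute w l.prod := by
  induction l with
  | nil => exact Commute.one_right w
  | cons c l ih =>
    rw [List.prod_cons]
    exact (h c (by simp)).mul_right (ih fun d hd => h d (by simp [hd]))

theorem commute_list_prod_map {ι : Type*} {l : List ι} {f : ι → M} {w : M}
    (h : ∀ c ∈ l, Commute w (f c)) : Commute w (l.map f).prod :=
  commute_list_prod (by simpa using h)

/-- The product of the values of the letters of the word of `γ_{x,y}`. -/
def blockProd (φ : Label n → M) (x y : Fin k → Fin (n + 1)) : M :=
  ((List.finRange k).reverse.map fun a => ((rWord (x a) (y a)).map φ).prod).prod *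
    ((List.finRange k).map fun a => ((lWord (x a) (y a)).map φ).prod).prod

variable {φ : Label n → M} {x x' y : Fin k → Fin (n + 1)} {a : Fin k} {w : M}

theorem blockProd_self (x : Fin k → Fin (n + 1)) : blockProd φ x x = 1 := by
  simp [blockProd, rWord_eq_nil, lWord_eq_nil]

theorem blockProd_right (hx : ∀ b, b ≠ a → x' b = x b)
    (hc : ∀ b > a, ∀ l ∈ rWord (x b) (y b), Commute w (φ l))
    (hr : ((rWord (x a) (y a)).map φ).prod = w * ((rWord (x' a) (y a)).map φ).prod)
    (hl : lWord (x a) (y a) = lWord (x' a) (y a)) :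
    blockProd φ x y = w * blockProd φ x' y := by
  rw [blockProd, blockProd, ← mul_assoc]
  congr 1
  -- The list is reversed, so the blocks to the left of block `a` are those with `b > a`.
  · refine list_prod_map_eq_mul (r := fun b c => c < b) (fun b => lt_irrefl b)
      (List.pairwise_reverse.2 (List.pairwise_lt_finRange k)) (a := a) (by simp) (fun b hb => ?_)
      (fun b hb => commute_list_prod_map (hc b hb)) hr
    simp only [hx b hb]
  · congr 2
    funext b
    by_cases hb : b = a
    · rw [hb, hl]
    · rw [hx b hb]

theorem blockProd_left (hx : ∀ b, b ≠ a → x' b = x b)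
    (hcr : ∀ b, ∀ l ∈ rWord (x b) (y b), Commute w (φ l))
    (hcl : ∀ b < a, ∀ l ∈ lWord (x b) (y b), Commute w (φ l))
    (hr : rWord (x a) (y a) = rWord (x' a) (y a))
    (hl : ((lWord (x a) (y a)).map φ).prod = w * ((lWord (x' a) (y a)).map φ).prod) :
    blockProd φ x y = w * blockProd φ x' y := by
  have h1 : (fun b => ((rWord (x' b) (y b)).map φ).prod) =
      fun b => ((rWord (x b) (y b)).map φ).prod := by
    funext b
    by_cases hb : b = a
    · rw [hb, hr]
    · rw [hx b hb]
  -- The `R`-part is the same for `x` and `x'`, and `w` has to pass all of it before leaving the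
  -- `L`-part.
  rw [blockProd, blockProd, h1, ← mul_assoc,
    (commute_list_prod_map fun b _ => commute_list_prod_map (hcr b)).eq, mul_assoc]
  congr 1
  refine list_prod_map_eq_mul (r := fun b c => b < c) (fun b => lt_irrefl b)
    (List.pairwise_lt_finRange k) (a := a) (by simp) (fun b hb => ?_)
    (fun b hb => commute_list_prod_map (hcl b hb)) hl
  simp only [hx b hb]

end Block

/-! ### Words of paths -/

theorem word_nil (x : IState n k) : word (@Quiver.Path.nil _ (Gamma n k) x) = [] := rfl

theorem word_cons {x y z : IState n k} (p : QPath (Gamma n k) x y) (e : (Gamma n k).Hom y z) :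
    word (@Quiver.Path.cons _ (Gamma n k) _ _ _ p e) = word p ++ [e.1] := rfl

theorem word_arrowPath {x y : IState n k} (e : (Gamma n k).Hom x y) :
    word (arrowPath (Gamma n k) e) = [e.1] := rfl

theorem word_comp {x y z : IState n k} (p : QPath (Gamma n k) x y) (q : QPath (Gamma n k) y z) :
    word (@Quiver.Path.comp _ (Gamma n k) _ _ _ p q) = word p ++ word q := by
  let _ : Quiver (IState n k) := Gamma n k
  induction q with
  | nil => rw [Quiver.Path.comp_nil, word_nil, List.append_nil]
  | cons q e ih => rw [Quiver.Path.comp_cons, word_cons, word_cons, ih, List.append_assoc]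

/-- A path is determined by its start and its word. -/
theorem sigma_eq_of_word_eq {x y y' : IState n k} (p : QPath (Gamma n k) x y)
    (q : QPath (Gamma n k) x y') (h : word p = word q) :
    (⟨y, p⟩ : Σ y, QPath (Gamma n k) x y) = ⟨y', q⟩ := by
  let _ : Quiver (IState n k) := Gamma n k
  -- The end must vary: the last arrows of the two paths may a priori start at different vertices.
  induction p generalizing y' with
  | nil =>
    cases q with
    | nil => rfl
    | cons q e => rw [word_nil, word_cons] at h; simp at h
  | cons p e ih =>
    cases q with
    | nil => rw [word_nil, word_cons] at h; simp at h
    | cons q e' =>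
      rw [word_cons, word_cons] at h
      obtain ⟨h1, h2⟩ := List.append_inj' h rfl
      obtain ⟨c, hc⟩ := e
      obtain ⟨c', hc'⟩ := e'
      cases ih q h1
      obtain rfl : c = c' := by simpa using h2
      cases hc.eq_right hc'
      rfl

theorem eq_of_word_eq {x y : IState n k} {p q : QPath (Gamma n k) x y} (h : word p = word q) :
    p = q := by
  simpa using sigma_eq_of_word_eq p q h

/-! ### Existence and uniqueness of the paths `γ_{x,y}` -/

theorem IState.Fits.val_eq {x y : IState n k} {a : Fin k} {t : Fin (n + 1)} (h : x.Fits a t)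
    (hy : y.dot = Function.update x.dot a t) : y.1 = insert t (x.1 \ {x.dot a}) := by
  obtain ⟨y', hy'⟩ := h.exists_move
  rw [← hy', IState.ext_dot (x := y) (y := y') fun b => by rw [hy, h.dot_eq hy']]

/-- The dot advances one position at a time. The dots above it stay put beyond `m`, so each next
position is free. -/
theorem exists_path_right (a : Fin k) (m : Fin (n + 1)) (x : IState n k) (h1 : x.dot a ≤ m)
    (h2 : ∀ b > a, m < x.dot b) :
    ∃ (x' : IState n k) (p : QPath (Gamma n k) x x'),
      x'.dot = Function.update x.dot a m ∧ word p = rWord (x.dot a) m := by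
  induction hd : (m : ℕ) - x.dot a generalizing x with
  | zero =>
    obtain rfl : m = x.dot a := le_antisymm (Fin.le_def.2 (by omega)) h1
    exact ⟨x, @Quiver.Path.nil _ (Gamma n k) x, by simp, by simp [rWord_eq_nil, word_nil]⟩
  | succ d ih =>
    have hlt : x.dot a < m := Fin.lt_def.2 (by omega)
    obtain ⟨i, hi⟩ := Fin.exists_castSucc_eq.2 (ne_of_lt (hlt.trans_le (Fin.le_last _)))
    have hle : i.succ ≤ m := Fin.castSucc_lt_iff_succ_le.1 (hi ▸ hlt)
    have hf : x.Fits a i.succ :=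
      ⟨fun b hb => (x.dot_strictMono hb).trans (hi ▸ i.castSucc_lt_succ),
        fun b hb => hle.trans_lt (h2 b hb)⟩
    obtain ⟨x₁, hx₁⟩ := hf.exists_move
    have he := isArrow_R_of_dots hi.symm hf hx₁
    have hdot := hf.dot_eq hx₁
    have ha : x₁.dot a = i.succ := by simp [hdot]
    obtain ⟨x', p, hx', hp⟩ := ih x₁ (ha ▸ hle)
      (fun b hb => by rw [hdot, Function.update_of_ne hb.ne']; exact h2 b hb)
      (by rw [ha, Fin.val_succ]; rw [← hi, Fin.val_castSucc] at hd; omega)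
    refine ⟨x', @Quiver.Path.comp _ (Gamma n k) _ _ _ (arrowPath (Gamma n k) ⟨.R i, he⟩) p, ?_, ?_⟩
    · rw [hx', hdot, Function.update_idem]
    · rw [word_comp, word_arrowPath, hp, ha, ← hi, rWord_cons hle]; rfl

theorem exists_path_left (a : Fin k) (m : Fin (n + 1)) (x : IState n k) (h1 : m ≤ x.dot a)
    (h2 : ∀ b < a, x.dot b < m) :
    ∃ (x' : IState n k) (p : QPath (Gamma n k) x x'),
      x'.dot = Function.update x.dot a m ∧ word p = lWord (x.dot a) m := by
  induction hd : (x.dot a : ℕ) - m generalizing x with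
  | zero =>
    obtain rfl : m = x.dot a := le_antisymm h1 (Fin.le_def.2 (by omega))
    exact ⟨x, @Quiver.Path.nil _ (Gamma n k) x, by simp, by simp [lWord_eq_nil, word_nil]⟩
  | succ d ih =>
    have hlt : m < x.dot a := Fin.lt_def.2 (by omega)
    obtain ⟨i, hi⟩ := Fin.exists_succ_eq.2 (ne_of_gt ((Fin.zero_le _).trans_lt hlt))
    have hle : m ≤ i.castSucc := Fin.le_castSucc_iff.2 (hi ▸ hlt)
    have hf : x.Fits a i.castSucc :=
      ⟨fun b hb => (h2 b hb).trans_le hle,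
        fun b hb => (hi ▸ i.castSucc_lt_succ : i.castSucc < x.dot a).trans (x.dot_strictMono hb)⟩
    obtain ⟨x₁, hx₁⟩ := hf.exists_move
    have he := isArrow_L_of_dots hi.symm hf hx₁
    have hdot := hf.dot_eq hx₁
    have ha : x₁.dot a = i.castSucc := by simp [hdot]
    obtain ⟨x', p, hx', hp⟩ := ih x₁ (ha ▸ hle)
      (fun b hb => by rw [hdot, Function.update_of_ne hb.ne]; exact h2 b hb)
      (by rw [ha, Fin.val_castSucc]; rw [← hi, Fin.val_succ] at hd; omega)
    refine ⟨x', @Quiver.Path.comp _ (Gamma n k) _ _ _ (arrowPath (Gamma n k) ⟨.L i, he⟩) p, ?_, ?_⟩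
    · rw [hx', hdot, Function.update_idem]
    · rw [word_comp, word_arrowPath, hp, ha, ← hi, lWord_cons hle]; rfl

theorem exists_isGammaPath (x y : IState n k) :
    ∃ γ : QPath (Gamma n k) x y, IsGammaPath γ := by
  induction hd : dotDist x y using Nat.strong_induction_on generalizing x with
  | _ d ih =>
  subst hd
  -- A block brings a misplaced dot to its target and leaves the others alone, so the total distance
  -- drops and the recursion terminates.
  have hlt {x' : IState n k} {a : Fin k} (ha : x.dot a ≠ y.dot a)
      (hx' : x'.dot = Function.update x.dot a (y.dot a)) : dotDist x' y < dotDist x y := by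
    refine dotDist_lt hx' ?_
    rw [Nat.dist_self]
    exact Nat.dist_pos_of_ne fun h => ha (Fin.ext h)
  by_cases h : ∃ a, x.dot a < y.dot a
  · obtain ⟨a, ha, hmax⟩ := exists_max_fin h
    have hf := IState.fits_right hmax ha.le le_rfl
    obtain ⟨x', p, hx', hp⟩ := exists_path_right a (y.dot a) x ha.le hf.above
    obtain ⟨q, hq⟩ := ih _ (hlt ha.ne hx') x' rfl
    exact ⟨_, IsGammaPath.right a ha hmax (hf.val_eq hx') p hp q hq⟩
  by_cases h' : ∃ a, y.dot a < x.dot a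
  · obtain ⟨a, ha, hmin⟩ := exists_min_fin h'
    have hf := IState.fits_left hmin le_rfl ha.le
    obtain ⟨x', p, hx', hp⟩ := exists_path_left a (y.dot a) x ha.le hf.below
    obtain ⟨q, hq⟩ := ih _ (hlt ha.ne' hx') x' rfl
    push Not at h
    exact ⟨_, IsGammaPath.left h a ha hmin (hf.val_eq hx') p hp q hq⟩
  push Not at h h'
  obtain rfl : x = y := IState.ext_dot fun a => le_antisymm (h' a) (h a)
  exact ⟨_, IsGammaPath.nil x⟩

/-- The dot moved first owns the first nonempty block, because the blocks before it are empty by the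
extremal choice of `a`; the commutation hypotheses are therefore vacuous. The monoid is arbitrary
since two are needed: the free monoid gives uniqueness of γ, the quiver algebra gives the class of
γ. -/
theorem IsGammaPath.prod_word {M : Type*} [Monoid M] (φ : Label n → M) {x y : IState n k}
    {γ : QPath (Gamma n k) x y} (h : IsGammaPath γ) :
    ((word γ).map φ).prod = blockProd φ x.dot y.dot := by
  induction h with
  | nil x => rw [blockProd_self]; rfl
  | @right x x' y a ha hmax hx' p hp q hq ih =>
    have hdot := (IState.fits_right hmax ha.le le_rfl).dot_eq hx'
    rw [word_comp, List.map_append, List.prod_append, ih, hp]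
    refine (blockProd_right (a := a) (fun b hb => by rw [hdot, Function.update_of_ne hb]) ?_ ?_
      ?_).symm
    · intro b hb l hl
      rw [rWord_eq_nil (not_lt.1 fun h => (hmax b h).not_gt hb)] at hl
      simp at hl
    · rw [hdot, Function.update_self, rWord_eq_nil (le_refl (y.dot a)), List.map_nil,
        List.prod_nil, mul_one]
    · rw [hdot, Function.update_self, lWord_eq_nil le_rfl, lWord_eq_nil ha.le]
  | @left x x' y hle a ha hmin hx' p hp q hq ih =>
    have hdot := (IState.fits_left hmin le_rfl ha.le).dot_eq hx'
    rw [word_comp, List.map_append, List.prod_append, ih, hp]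
    refine (blockProd_left (a := a) (fun b hb => by rw [hdot, Function.update_of_ne hb]) ?_ ?_
      ?_ ?_).symm
    · intro b l hl
      rw [rWord_eq_nil (hle b)] at hl
      simp at hl
    · intro b hb l hl
      rw [lWord_eq_nil (not_lt.1 fun h => (hmin b h).not_gt hb)] at hl
      simp at hl
    · rw [hdot, Function.update_self, rWord_eq_nil le_rfl, rWord_eq_nil ha.le]
    · rw [hdot, Function.update_self, lWord_eq_nil (le_refl (y.dot a)), List.map_nil,
        List.prod_nil, mul_one]

/-- In the free monoid the product of the letters is the word itself, so the closed form shows that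
the word depends only on `x` and `y`. -/
theorem IsGammaPath.unique {x y : IState n k} {γ γ' : QPath (Gamma n k) x y}
    (h : IsGammaPath γ) (h' : IsGammaPath γ') : γ = γ' := by
  refine eq_of_word_eq ?_
  have e (l : List (Label n)) : FreeMonoid.toList (l.map FreeMonoid.of).prod = l := by
    induction l with
    | nil => rfl
    | cons c l ih => rw [List.map_cons, List.prod_cons, FreeMonoid.toList_of_mul, ih]
  rw [← e (word γ), ← e (word γ'), h.prod_word, h'.prod_word]

/-! ### Commuting arrows -/

/-- A dot of `x` moves from `s` to `t`. -/
def IsMove (s t : Fin (n + 1)) (x y : IState n k) : Prop :=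
  s ∈ x.1 ∧ t ∉ x.1 ∧ y.1 = insert t (x.1 \ {s})

/-- The two moves touch disjoint pairs of positions, so neither affects whether the other is
possible. This supplies the second path that a distant commutation relation needs. -/
theorem IsMove.swap {s t s' t' : Fin (n + 1)} {x y z : IState n k} (h : IsMove s t x y)
    (h' : IsMove s' t' y z) (hss : s ≠ s') (hst : s ≠ t') (hts : t ≠ s') (htt : t ≠ t') :
    ∃ y', IsMove s' t' x y' ∧ IsMove s t y' z := by
  obtain ⟨h1, h2, h3⟩ := h
  obtain ⟨h1', h2', h3'⟩ := h'
  simp only [h3, Finset.mem_insert, Finset.mem_sdiff, Finset.mem_singleton] at h1' h2'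
  have hs' : s' ∈ x.1 := by grind
  have ht' : t' ∉ x.1 := by grind
  have hcard : (insert t' (x.1 \ {s'})).card = k := by
    rw [Finset.card_insert_of_notMem fun h => ht' (Finset.mem_sdiff.1 h).1,
      Finset.card_sdiff_of_subset (by simpa using hs'), Finset.card_singleton]
    have := Finset.card_pos.2 ⟨s', hs'⟩
    have := x.2
    omega
  refine ⟨⟨_, hcard⟩, ⟨hs', ht', rfl⟩, ?_, ?_, ?_⟩
  · simp only [Finset.mem_insert, Finset.mem_sdiff, Finset.mem_singleton]; grind
  · simp only [Finset.mem_insert, Finset.mem_sdiff, Finset.mem_singleton]; grind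
  · ext r
    simp only [h3, h3', Finset.mem_insert, Finset.mem_sdiff, Finset.mem_singleton]; grind

/-! ### Sums of equally labelled arrows and their commutation. -/

namespace GammaAlgebra

/-- The class of the empty path at `x`. -/
def vertex (x : IState n k) : GammaAlgebra n k :=
  GammaAlgebra.ofPath (@Quiver.Path.nil _ (Gamma n k) x)

/-- The class of the arrow from `x` to `y` with label `l`. -/
def arrow {l : Label n} {x y : IState n k} (h : IsArrow l x y) : GammaAlgebra n k :=
  GammaAlgebra.ofPath (arrowPath (Gamma n k) ⟨l, h⟩)

open Classical in
/-- The sum of all arrows with label `l`. -/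
def letter (l : Label n) : GammaAlgebra n k :=
  ∑ x : IState n k, ∑ y : IState n k, if h : IsArrow l x y then arrow h else 0

theorem completeOrthogonalIdempotents_vertex :
    CompleteOrthogonalIdempotents (vertex : IState n k → GammaAlgebra n k) :=
  completeOrthogonalIdempotents_toQuiv

theorem vertex_mul_ofPath {x y : IState n k} (p : QPath (Gamma n k) x y) :
    vertex x * GammaAlgebra.ofPath p = GammaAlgebra.ofPath p := by
  let _ : Quiver (IState n k) := Gamma n k
  rw [vertex, ofPath_mul, Quiver.Path.nil_comp]

theorem ofPath_mul_vertex {x y : IState n k} (p : QPath (Gamma n k) x y) :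
    GammaAlgebra.ofPath p * vertex y = GammaAlgebra.ofPath p := by
  let _ : Quiver (IState n k) := Gamma n k
  rw [vertex, ofPath_mul, Quiver.Path.comp_nil]

theorem arrow_mul_vertex {l : Label n} {x y : IState n k} (h : IsArrow l x y) :
    arrow h * vertex y = arrow h := ofPath_mul_vertex _

theorem vertex_mul_arrow_of_ne {l : Label n} {x x' y : IState n k} (h : IsArrow l x' y)
    (hx : x ≠ x') : vertex x * arrow h = 0 := ofPath_mul_of_ne _ _ hx

/-- The vertices sum to `1`, so identities can be checked at one starting vertex at a time. -/
theorem eq_of_vertex_mul {a b : GammaAlgebra n k} (h : ∀ x, vertex x * a = vertex x * b) :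
    a = b := by
  rw [← one_mul a, ← one_mul b, ← completeOrthogonalIdempotents_vertex.complete, Finset.sum_mul,
    Finset.sum_mul]
  exact Finset.sum_congr rfl fun x _ => h x

theorem vertex_mul_letter {l : Label n} {x y : IState n k} (h : IsArrow l x y) :
    vertex x * letter l = arrow h := by
  rw [letter, Finset.mul_sum, Finset.sum_eq_single x, Finset.sum_eq_single y, dif_pos h]
  · exact vertex_mul_ofPath _
  · intro y' _ hy'
    rw [dif_neg fun h' => hy' (h'.eq_right h)]
  · simp
  · intro x' _ hx'
    rw [Finset.mul_sum]
    refine Finset.sum_eq_zero fun y' _ => ?_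
    split_ifs with h'
    · exact vertex_mul_arrow_of_ne h' hx'.symm
    · exact mul_zero _
  · simp

theorem vertex_mul_letter_eq_zero {l : Label n} {x : IState n k} (h : ∀ y, ¬ IsArrow l x y) :
    vertex x * letter l = 0 := by
  rw [letter, Finset.mul_sum]
  refine Finset.sum_eq_zero fun x' _ => ?_
  rw [Finset.mul_sum]
  refine Finset.sum_eq_zero fun y' _ => ?_
  split_ifs with h'
  · exact vertex_mul_arrow_of_ne h' fun hx => h y' (hx ▸ h')
  · exact mul_zero _

theorem arrow_mul_letter {l l' : Label n} {x y z : IState n k} (h : IsArrow l x y)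
    (h' : IsArrow l' y z) : arrow h * letter l' = arrow h * arrow h' := by
  rw [← arrow_mul_vertex h, mul_assoc, vertex_mul_letter h', arrow_mul_vertex]

/-- A single vertex on the left fixes the whole path. The remaining product of letters can be
rearranged without tracking intermediate vertices. -/
theorem ofPath_eq_vertex_mul_prod {x y : IState n k} (p : QPath (Gamma n k) x y) :
    GammaAlgebra.ofPath p = vertex x * ((word p).map letter).prod := by
  let _ : Quiver (IState n k) := Gamma n k
  induction p with
  | nil => rw [word_nil, List.map_nil, List.prod_nil, mul_one]; rfl
  | @cons y z p e ih =>
    have h : GammaAlgebra.ofPath (n := n) (k := k) (Quiver.Path.cons p e)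
        = GammaAlgebra.ofPath p * GammaAlgebra.ofPath (arrowPath (Gamma n k) e) := by
      rw [GammaAlgebra.ofPath_mul]; rfl
    have h' : GammaAlgebra.ofPath (arrowPath (Gamma n k) e) = vertex y * letter e.1 :=
      (vertex_mul_letter e.2).symm
    rw [h, h', ← mul_assoc, ofPath_mul_vertex, ih, word_cons, List.map_append, List.prod_append,
      mul_assoc, List.map_singleton, List.prod_singleton]

theorem arrow_mul_arrow_eq {l₁ l₂ m₁ m₂ : Label n} {x y y' z : IState n k}
    (h₁ : IsArrow l₁ x y) (h₂ : IsArrow l₂ y z) (h₁' : IsArrow m₁ x y') (h₂' : IsArrow m₂ y' z)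
    (h : WordRel [l₁, l₂] [m₁, m₂]) : arrow h₁ * arrow h₂ = arrow h₁' * arrow h₂' := by
  rw [arrow, arrow, arrow, arrow, ofPath_mul, ofPath_mul]
  exact toQuiv_eq (GammaRel.mk _ _ h)

theorem arrow_mul_arrow_eq_uLoop {l₁ l₂ : Label n} {i : Fin n} {x y : IState n k}
    (h₁ : IsArrow l₁ x y) (h₂ : IsArrow l₂ y x) (h : WordRel [l₁, l₂] [.U i]) :
    arrow h₁ * arrow h₂ = GammaAlgebra.ofPath (uLoop x i) := by
  rw [arrow, arrow, ofPath_mul]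
  exact toQuiv_eq (GammaRel.mk _ _ h)

theorem vertex_mul_letter_mul_letter {l l' : Label n}
    (hs : ∀ x y z : IState n k, IsArrow l x y → IsArrow l' y z →
      ∃ y', IsArrow l' x y' ∧ IsArrow l y' z)
    (h : WordRel [l, l'] [l', l]) {x y z : IState n k} (h₁ : IsArrow l x y) (h₂ : IsArrow l' y z) :
    vertex x * (letter l * letter l') = vertex x * (letter l' * letter l) := by
  obtain ⟨y', h₁', h₂'⟩ := hs x y z h₁ h₂
  rw [← mul_assoc, ← mul_assoc, vertex_mul_letter h₁, vertex_mul_letter h₁', arrow_mul_letter h₁ h₂,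
    arrow_mul_letter h₁' h₂', arrow_mul_arrow_eq h₁ h₂ h₁' h₂' h]

theorem vertex_mul_letter_mul_letter_eq_zero {l l' : Label n} {x : IState n k}
    (h : ∀ y z, IsArrow l x y → ¬ IsArrow l' y z) : vertex x * (letter l * letter l') = 0 := by
  rw [← mul_assoc]
  by_cases hx : ∃ y, IsArrow l x y
  · obtain ⟨y, hy⟩ := hx
    rw [vertex_mul_letter hy, ← arrow_mul_vertex, mul_assoc,
      vertex_mul_letter_eq_zero fun z => h y z hy, mul_zero]
  · rw [vertex_mul_letter_eq_zero (not_exists.1 hx), zero_mul]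

/-- At each starting vertex the two composites either both exist, and a relation identifies them, or
both are absent and give `0`. The two swapping hypotheses exclude the mixed case. -/
theorem commute_letter {l l' : Label n}
    (hs : ∀ x y z : IState n k, IsArrow l x y → IsArrow l' y z →
      ∃ y', IsArrow l' x y' ∧ IsArrow l y' z)
    (hs' : ∀ x y z : IState n k, IsArrow l' x y → IsArrow l y z →
      ∃ y', IsArrow l x y' ∧ IsArrow l' y' z)
    (h : WordRel [l, l'] [l', l]) :
    Commute (letter l : GammaAlgebra n k) (letter l') := by
  refine eq_of_vertex_mul fun x => ?_
  by_cases h₁ : ∃ y z, IsArrow l x y ∧ IsArrow l' y z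
  · obtain ⟨y, z, hy, hz⟩ := h₁
    exact vertex_mul_letter_mul_letter hs h hy hz
  · rw [vertex_mul_letter_mul_letter_eq_zero fun y z hy hz => h₁ ⟨y, z, hy, hz⟩,
      vertex_mul_letter_mul_letter_eq_zero fun y z hy hz => h₁ ?_]
    obtain ⟨y', h₁', h₂'⟩ := hs' x y z hy hz
    exact ⟨y', z, h₁', h₂'⟩

theorem far_ne {i j : Fin n} (h : 1 < |((i : ℕ) : ℤ) - ((j : ℕ) : ℤ)|) :
    i.castSucc ≠ j.castSucc ∧ i.castSucc ≠ j.succ ∧ i.succ ≠ j.castSucc ∧ i.succ ≠ j.succ := by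
  simp only [ne_eq, Fin.ext_iff, Fin.val_succ, Fin.val_castSucc]
  grind

theorem commute_letter_RR {i j : Fin n} (h : 1 < |((i : ℕ) : ℤ) - ((j : ℕ) : ℤ)|) :
    Commute (letter (.R i) : GammaAlgebra n k) (letter (.R j)) := by
  obtain ⟨h1, h2, h3, h4⟩ := far_ne h
  exact commute_letter (fun x y z hy hz => IsMove.swap hy hz h1 h2 h3 h4)
    (fun x y z hy hz => IsMove.swap hy hz h1.symm h3.symm h2.symm h4.symm) (.distant_RR i j h)

theorem commute_letter_LL {i j : Fin n} (h : 1 < |((i : ℕ) : ℤ) - ((j : ℕ) : ℤ)|) :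
    Commute (letter (.L i) : GammaAlgebra n k) (letter (.L j)) := by
  obtain ⟨h1, h2, h3, h4⟩ := far_ne h
  exact commute_letter (fun x y z hy hz => IsMove.swap hy hz h4 h3 h2 h1)
    (fun x y z hy hz => IsMove.swap hy hz h4.symm h2.symm h3.symm h1.symm) (.distant_LL i j h)

theorem commute_letter_RL {i j : Fin n} (h : 1 < |((i : ℕ) : ℤ) - ((j : ℕ) : ℤ)|) :
    Commute (letter (.R i) : GammaAlgebra n k) (letter (.L j)) := by
  obtain ⟨h1, h2, h3, h4⟩ := far_ne h
  exact commute_letter (fun x y z hy hz => IsMove.swap hy hz h2 h1 h4 h3)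
    (fun x y z hy hz => IsMove.swap hy hz h2.symm h4.symm h1.symm h3.symm) (.distant_RL i j h)

/-! ### The classes of the paths `γ_{x,y}` and their products -/

/-- The `R`-blocks preceding block `a` belong to dots beyond `i.succ`, so their labels have indices
at least `i + 2` and commute with `R i`. -/
theorem blockProd_arrow_R {x x' z : IState n k} {i : Fin n} {a : Fin k}
    (ha : x.dot a = i.castSucc) (hf : x.Fits a i.succ)
    (hx' : x'.dot = Function.update x.dot a i.succ) (hz : x.dot a < z.dot a) :
    blockProd (letter : Label n → GammaAlgebra n k) x.dot z.dot =
      letter (.R i) * blockProd letter x'.dot z.dot := by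
  have hle : i.succ ≤ z.dot a := Fin.castSucc_lt_iff_succ_le.1 (ha ▸ hz)
  refine blockProd_right (a := a) (fun b hb => by rw [hx', Function.update_of_ne hb]) ?_ ?_ ?_
  · intro b hb l hl
    obtain ⟨j, rfl, h1, -⟩ := mem_rWord hl
    have h2 := (hf.above b hb).trans_le h1
    refine commute_letter_RR ?_
    rw [Fin.lt_def, Fin.val_succ, Fin.val_castSucc] at h2
    grind
  · rw [hx', Function.update_self, ha, rWord_cons hle, List.map_cons, List.prod_cons]
  · rw [hx', Function.update_self, lWord_eq_nil hz.le, lWord_eq_nil hle]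

/-- Here the letter must pass every `R`-block. Those of dots below `a` end at positions below `z.dot
a`, hence far to the left; those of dots above `a` start beyond `x.dot a`; block `a` has no
`R`-letters. -/
theorem blockProd_arrow_L {x x' z : IState n k} {i : Fin n} {a : Fin k}
    (ha : x.dot a = i.succ) (hf : x.Fits a i.castSucc)
    (hx' : x'.dot = Function.update x.dot a i.castSucc) (hz : z.dot a < x.dot a) :
    blockProd (letter : Label n → GammaAlgebra n k) x.dot z.dot =
      letter (.L i) * blockProd letter x'.dot z.dot := by
  have hle : z.dot a ≤ i.castSucc := Fin.le_castSucc_iff.2 (ha ▸ hz)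
  refine blockProd_left (a := a) (fun b hb => by rw [hx', Function.update_of_ne hb]) ?_ ?_ ?_ ?_
  · intro b l hl
    obtain ⟨j, rfl, h1, h2⟩ := mem_rWord hl
    refine (commute_letter_RL ?_).symm
    rcases lt_trichotomy b a with hb | rfl | hb
    · have h3 := (h2.trans_lt (z.dot_strictMono hb)).trans_le hle
      rw [Fin.lt_def, Fin.val_succ, Fin.val_castSucc] at h3
      grind
    · exact absurd (((h1.trans_lt j.castSucc_lt_succ).trans_le h2).trans hz) (lt_irrefl _)
    · have h3 := (ha ▸ x.dot_strictMono hb).trans_le h1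
      rw [Fin.lt_def, Fin.val_succ, Fin.val_castSucc] at h3
      grind
  · intro b hb l hl
    obtain ⟨j, rfl, -, h1⟩ := mem_lWord hl
    have h2 := h1.trans_lt (hf.below b hb)
    refine commute_letter_LL ?_
    rw [Fin.lt_def, Fin.val_succ, Fin.val_castSucc] at h2
    grind
  · rw [hx', Function.update_self, rWord_eq_nil hz.le, rWord_eq_nil hle]
  · rw [hx', Function.update_self, ha, lWord_cons hle, List.map_cons, List.prod_cons]

/-- The class of the path `γ_{x,y}`. -/
def gammaElt (x y : IState n k) : GammaAlgebra n k := vertex x * blockProd letter x.dot y.dot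

theorem _root_.OSz.IsGammaPath.ofPath_eq {x y : IState n k} {γ : QPath (Gamma n k) x y}
    (h : IsGammaPath γ) : GammaAlgebra.ofPath γ = gammaElt x y := by
  rw [ofPath_eq_vertex_mul_prod, h.prod_word, gammaElt]

theorem gammaElt_self (x : IState n k) : gammaElt x x = vertex x := by
  rw [gammaElt, blockProd_self, mul_one]

theorem vertex_mul_gammaElt (x y : IState n k) : vertex x * gammaElt x y = gammaElt x y := by
  rw [gammaElt, ← mul_assoc, completeOrthogonalIdempotents_vertex.idem x]

/-- The defining product displays only the start; the end is read off from an actual path γ. -/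
theorem gammaElt_mul_vertex (x y : IState n k) : gammaElt x y * vertex y = gammaElt x y := by
  obtain ⟨γ, hγ⟩ := exists_isGammaPath x y
  rw [← hγ.ofPath_eq, ofPath_mul_vertex]

theorem arrow_mul_gammaElt {l : Label n} {x x' z : IState n k} (h : IsArrow l x x') :
    arrow h * gammaElt x' z = arrow h * blockProd letter x'.dot z.dot := by
  rw [gammaElt, ← mul_assoc, arrow_mul_vertex]

theorem X_smul (i : Fin n) (a : GammaAlgebra n k) :
    (MvPolynomial.X i : UPoly n) • a = GammaAlgebra.u i * a := by
  rw [Algebra.smul_def]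
  congr 1
  change ((polyHom n k (MvPolynomial.X i) : Subalgebra.center _ _) : GammaAlgebra n k) = _
  rw [polyHom, MvPolynomial.aeval_X]

theorem uLoop_eq (x : IState n k) (i : Fin n) :
    GammaAlgebra.ofPath (uLoop x i) = (MvPolynomial.X i : UPoly n) • vertex x := by
  let _ : Quiver (IState n k) := Gamma n k
  rw [X_smul, vertex, u_mul_ofPath, ofPath_mul, Quiver.Path.comp_nil]

/-- The block product from `x'` starts by undoing the arrow, and the resulting two-step loop is
`U_i`. -/
theorem arrow_mul_gammaElt_of_loop {l l' : Label n} {i : Fin n} {x x' z : IState n k}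
    (h : IsArrow l x x') (h' : IsArrow l' x' x) (hl : WordRel [l, l'] [.U i])
    (hz : blockProd (letter : Label n → GammaAlgebra n k) x'.dot z.dot =
      letter l' * blockProd letter x.dot z.dot) :
    arrow h * gammaElt x' z = (MvPolynomial.X i : UPoly n) • gammaElt x z := by
  rw [arrow_mul_gammaElt, hz, ← mul_assoc, arrow_mul_letter h h', arrow_mul_arrow_eq_uLoop h h' hl,
    uLoop_eq, smul_mul_assoc, gammaElt]

/-- The composition law when the first factor is a single arrow: the arrow either extends γ towards
`z` or is cancelled by its first backward letter. -/
theorem arrow_R_mul_gammaElt {i : Fin n} {x x' : IState n k} (h : IsArrow (.R i) x x')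
    (z : IState n k) : arrow h * gammaElt x' z = weightMonomial x x' z • gammaElt x z := by
  obtain ⟨a, ha, hf, hx'⟩ := h.dots_R
  by_cases hz : x.dot a < z.dot a
  · rw [weightMonomial_R_of_lt h (relWeight_pos_of_dot_lt ha hz), one_smul, arrow_mul_gammaElt,
      gammaElt, blockProd_arrow_R ha hf hx' hz, ← mul_assoc, vertex_mul_letter h]
  · have ha' : x'.dot a = i.succ := by rw [hx', Function.update_self]
    have hz' : z.dot a < x'.dot a := by
      rw [ha']; exact ((not_lt.1 hz).trans ha.le).trans_lt i.castSucc_lt_succ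
    -- The reverse arrow leads from `x'` back to `x` and approaches `z`, so `blockProd_arrow_L`
    -- applies to it.
    have hx : x.dot = Function.update x'.dot a i.castSucc := by
      rw [hx', Function.update_idem, ← ha, Function.update_eq_self]
    rw [weightMonomial_R_of_le h (relWeight_neg_of_dot_lt ha' hz')]
    exact arrow_mul_gammaElt_of_loop h h.symm_R (.loop_RL i)
      (blockProd_arrow_L ha' (IState.fits_of_L h.symm_R.2.1 ha') hx hz')

theorem arrow_L_mul_gammaElt {i : Fin n} {x x' : IState n k} (h : IsArrow (.L i) x x')
    (z : IState n k) : arrow h * gammaElt x' z = weightMonomial x x' z • gammaElt x z := by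
  obtain ⟨a, ha, hf, hx'⟩ := h.dots_L
  by_cases hz : z.dot a < x.dot a
  · rw [weightMonomial_L_of_lt h (relWeight_neg_of_dot_lt ha hz), one_smul, arrow_mul_gammaElt,
      gammaElt, blockProd_arrow_L ha hf hx' hz, ← mul_assoc, vertex_mul_letter h]
  · have ha' : x'.dot a = i.castSucc := by rw [hx', Function.update_self]
    have hz' : x'.dot a < z.dot a := by
      rw [ha']; exact i.castSucc_lt_succ.trans_le (ha.ge.trans (not_lt.1 hz))
    have hx : x.dot = Function.update x'.dot a i.succ := by
      rw [hx', Function.update_idem, ← ha, Function.update_eq_self]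
    rw [weightMonomial_L_of_le h (relWeight_pos_of_dot_lt ha' hz')]
    exact arrow_mul_gammaElt_of_loop h h.symm_L (.loop_LR i)
      (blockProd_arrow_R ha' (IState.fits_of_R h.symm_L.2.1 ha') hx hz')

theorem arrow_R_eq_gammaElt {i : Fin n} {x y : IState n k} (h : IsArrow (.R i) x y) :
    arrow h = gammaElt x y := by
  rw [← arrow_mul_vertex h, ← gammaElt_self, arrow_R_mul_gammaElt, weightMonomial_self_right,
    one_smul]

theorem arrow_L_eq_gammaElt {i : Fin n} {x y : IState n k} (h : IsArrow (.L i) x y) :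
    arrow h = gammaElt x y := by
  rw [← arrow_mul_vertex h, ← gammaElt_self, arrow_L_mul_gammaElt, weightMonomial_self_right,
    one_smul]

/-- A property of `x` that is preserved by the arrows which split off the first letter of
`γ_{x,y}`. -/
theorem gammaElt_induction (y : IState n k) {P : IState n k → Prop} (refl : P y)
    (step : ∀ x x', weightMonomial x x' y = 1 →
      (∀ z, gammaElt x x' * gammaElt x' z = weightMonomial x x' z • gammaElt x z) →
      ((∃ i, IsArrow (.R i) x x') ∨ ∃ i, IsArrow (.L i) x x') → P x' → P x)
    (x : IState n k) : P x := by
  refine IState.induction_towards y refl (fun x x' i a h ha hlt hP => ?_)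
    (fun x x' i a h ha hlt hP => ?_) x
  · refine step x x' (weightMonomial_R_of_lt h (relWeight_pos_of_dot_lt ha hlt)) (fun z => ?_)
      (Or.inl ⟨i, h⟩) hP
    rw [← arrow_R_eq_gammaElt h, arrow_R_mul_gammaElt]
  · refine step x x' (weightMonomial_L_of_lt h (relWeight_neg_of_dot_lt ha hlt)) (fun z => ?_)
      (Or.inr ⟨i, h⟩) hP
    rw [← arrow_L_eq_gammaElt h, arrow_L_mul_gammaElt]

/-- A first step `x → x'` towards `y` has monomial `1`, so γ from `x` to `y` factors through `x'`.
The monomials of the two remaining products combine by the cocycle identity for `x, x', y, z`. -/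
theorem gammaElt_mul_gammaElt (x y z : IState n k) :
    gammaElt x y * gammaElt y z = weightMonomial x y z • gammaElt x z := by
  induction x using gammaElt_induction y with
  | refl => rw [gammaElt_self, vertex_mul_gammaElt, weightMonomial_self_left, one_smul]
  | step x x' h1 h2 _ ih =>
    have h3 := h2 y
    rw [h1, one_smul] at h3
    rw [← h3, mul_assoc, ih, mul_smul_comm, h2, smul_smul, mul_comm, weightMonomial_cocycle, h1,
      one_mul]

end GammaAlgebra

/-! ### The homomorphism from the quiver algebra to `B_0(n,k)` -/

namespace B0

/-- The quiver algebra is presented over `𝔽₂`, so its lift needs a target over `𝔽₂`; linearity over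
the polynomials is recovered in `toB0Aux_algebraMap`. -/
instance : Algebra (ZMod 2) (B0 n k) :=
  Algebra.compHom _ (algebraMap (ZMod 2) (UPoly n))

/-- The class of the empty path at `x`. -/
def vertex (x : IState n k) : B0 n k := toQuiv {r | B0Rel n k r} (idem _ _ x)

theorem completeOrthogonalIdempotents_vertex :
    CompleteOrthogonalIdempotents (vertex : IState n k → B0 n k) :=
  completeOrthogonalIdempotents_toQuiv

theorem f_self (x : IState n k) : f x x = vertex x := toQuiv_eq (B0Rel.unit x)

theorem f_mul_f (x y z : IState n k) : f x y * f y z = weightMonomial x y z • f x z := by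
  rw [f, f, f, ← map_mul, ← map_smul]
  exact toQuiv_eq (B0Rel.comp x y z)

/-- The coefficient of the image of an arrow with a given label. -/
def coeff : Label n → UPoly n
  | .U i => MvPolynomial.X i
  | .R _ => 1
  | .L _ => 1

/-- The image of an arrow of `Γ(n,k)`. -/
def arrowVal {x y : IState n k} (e : (Gamma n k).Hom x y) : B0 n k := coeff e.1 • f x y

theorem isRep_arrowVal :
    IsRep (Q := Gamma n k) (vertex : IState n k → B0 n k) (fun {_ _} e => arrowVal e) where
  left {x y} e := by
    rw [arrowVal, mul_smul_comm, ← f_self, f_mul_f, weightMonomial_self_left, one_smul]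
  right {x y} e := by
    rw [arrowVal, smul_mul_assoc, ← f_self, f_mul_f, weightMonomial_self_right, one_smul]

/-- The image of a path of `Γ(n,k)`. -/
abbrev val {x y : IState n k} (p : QPath (Gamma n k) x y) : B0 n k :=
  pathVal (Q := Gamma n k) vertex (fun {_ _} e => arrowVal e) p

theorem val_of_word_eq_one {x y : IState n k} {p : QPath (Gamma n k) x y} {l : Label n}
    (h : word p = [l]) : IsArrow l x y ∧ val p = coeff l • f x y := by
  cases p with
  | nil => simp [word_nil] at h
  | cons p e =>
    rw [word_cons] at h
    cases p with
    | cons p e' =>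
      rw [word_cons] at h
      exact absurd (congrArg List.length h) (by simp)
    | nil =>
      obtain rfl : e.1 = l := by simpa [word_nil] using h
      exact ⟨e.2, pathVal_arrowPath isRep_arrowVal e⟩

/-- The left side of every relation is a two-letter word, so this reduces the relations to computing
monomials. -/
theorem val_of_word_eq_two {x z : IState n k} {p : QPath (Gamma n k) x z} {l l' : Label n}
    (h : word p = [l, l']) : ∃ y, IsArrow l x y ∧ IsArrow l' y z ∧
      val p = (coeff l * coeff l' * weightMonomial x y z) • f x z := by
  cases p with
  | nil => simp [word_nil] at h
  | @cons y _ p e =>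
    rw [word_cons] at h
    obtain ⟨h1, h2⟩ := List.append_inj' (s₂ := [l]) (t₂ := [l']) h rfl
    obtain rfl : e.1 = l' := by simpa using h2
    obtain ⟨h3, h4⟩ := val_of_word_eq_one h1
    refine ⟨y, h3, e.2, ?_⟩
    refine (congrArg (· * arrowVal e) h4).trans ?_
    simp only [arrowVal, smul_mul_smul_comm, f_mul_f, smul_smul]

/-- The relative weights of both steps are nonnegative, so absolute values add and the defect
vanishes. -/
theorem weightMonomial_RR {i j : Fin n} {x y z : IState n k} (h : IsArrow (.R i) x y)
    (h' : IsArrow (.R j) y z) : weightMonomial x y z = 1 := by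
  refine weightMonomial_eq_one fun m => ?_
  rw [weightDefect, ← relWeight_add x y z, h.relWeight_R, h'.relWeight_R]
  split_ifs <;> simp

theorem weightMonomial_LL {i j : Fin n} {x y z : IState n k} (h : IsArrow (.L i) x y)
    (h' : IsArrow (.L j) y z) : weightMonomial x y z = 1 := by
  refine weightMonomial_eq_one fun m => ?_
  rw [weightDefect, ← relWeight_add x y z, h.relWeight_L, h'.relWeight_L]
  split_ifs <;> simp

/-- The two relative weights have disjoint supports, so absolute values add. -/
theorem weightMonomial_RL {i j : Fin n} (hij : i ≠ j) {x y z : IState n k}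
    (h : IsArrow (.R i) x y) (h' : IsArrow (.L j) y z) : weightMonomial x y z = 1 := by
  refine weightMonomial_eq_one fun m => ?_
  rw [weightDefect, ← relWeight_add x y z, h.relWeight_R, h'.relWeight_L]
  split_ifs with h1 h2 <;> first | exact absurd (h2.symm.trans h1) hij | simp

theorem weightMonomial_LR {i j : Fin n} (hij : i ≠ j) {x y z : IState n k}
    (h : IsArrow (.L i) x y) (h' : IsArrow (.R j) y z) : weightMonomial x y z = 1 := by
  refine weightMonomial_eq_one fun m => ?_
  rw [weightDefect, ← relWeight_add x y z, h.relWeight_L, h'.relWeight_R]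
  split_ifs with h1 h2 <;> first | exact absurd (h2.symm.trans h1) hij | simp

theorem ne_of_far {i j : Fin n} (h : 1 < |((i : ℕ) : ℤ) - ((j : ℕ) : ℤ)|) : i ≠ j := by
  rintro rfl
  simp at h

theorem val_eq_of_wordRel {x z : IState n k} {p q : QPath (Gamma n k) x z}
    (h : WordRel (word p) (word q)) : val p = val q := by
  generalize hp : word p = w at h
  generalize hq : word q = w' at h
  cases h with
  | central_R i j =>
    obtain ⟨y, h1, rfl, h3⟩ := val_of_word_eq_two hp
    obtain ⟨y', rfl, h2', h3'⟩ := val_of_word_eq_two hq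
    rw [h3, h3', weightMonomial_self_left, weightMonomial_self_right, mul_comm (coeff _)]
  | central_L i j =>
    obtain ⟨y, h1, rfl, h3⟩ := val_of_word_eq_two hp
    obtain ⟨y', rfl, h2', h3'⟩ := val_of_word_eq_two hq
    rw [h3, h3', weightMonomial_self_left, weightMonomial_self_right, mul_comm (coeff _)]
  | central_U i j =>
    obtain ⟨y, h1, rfl, h3⟩ := val_of_word_eq_two hp
    obtain ⟨y', rfl, h2', h3'⟩ := val_of_word_eq_two hq
    rw [h3, h3', weightMonomial_self_left, weightMonomial_self_right, mul_comm (coeff _)]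
  | loop_RL i =>
    obtain ⟨y, h1, h2, h3⟩ := val_of_word_eq_two hp
    obtain ⟨rfl, h3'⟩ := val_of_word_eq_one hq
    -- The way back along `L i` has relative weight `-1` at `i`, so the round trip contributes
    -- exactly `U_i`.
    rw [h3, h3', weightMonomial_R_of_le h1 (by rw [h2.relWeight_L, if_pos rfl]; decide)]
    simp [coeff]
  | loop_LR i =>
    obtain ⟨y, h1, h2, h3⟩ := val_of_word_eq_two hp
    obtain ⟨rfl, h3'⟩ := val_of_word_eq_one hq
    rw [h3, h3', weightMonomial_L_of_le h1 (by rw [h2.relWeight_R, if_pos rfl]; decide)]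
    simp [coeff]
  | distant_RR i j hij =>
    obtain ⟨y, h1, h2, h3⟩ := val_of_word_eq_two hp
    obtain ⟨y', h1', h2', h3'⟩ := val_of_word_eq_two hq
    rw [h3, h3', weightMonomial_RR h1 h2, weightMonomial_RR h1' h2']; rfl
  | distant_LL i j hij =>
    obtain ⟨y, h1, h2, h3⟩ := val_of_word_eq_two hp
    obtain ⟨y', h1', h2', h3'⟩ := val_of_word_eq_two hq
    rw [h3, h3', weightMonomial_LL h1 h2, weightMonomial_LL h1' h2']; rfl
  | distant_RL i j hij =>
    obtain ⟨y, h1, h2, h3⟩ := val_of_word_eq_two hp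
    obtain ⟨y', h1', h2', h3'⟩ := val_of_word_eq_two hq
    rw [h3, h3', weightMonomial_RL (ne_of_far hij) h1 h2,
      weightMonomial_LR (ne_of_far hij).symm h1' h2']; rfl

end B0

namespace GammaAlgebra

/-- The homomorphism to `B_0(n,k)` over `𝔽₂`. -/
def toB0Aux (n k : ℕ) : GammaAlgebra n k →ₐ[ZMod 2] B0 n k :=
  quivLift (pathLift B0.completeOrthogonalIdempotents_vertex B0.isRep_arrowVal) (by
    rintro _ ⟨p, q, h⟩
    rw [map_sub, pathLift_ofPath, pathLift_ofPath, sub_eq_zero]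
    exact B0.val_eq_of_wordRel h)

theorem toB0Aux_ofPath {x y : IState n k} (p : QPath (Gamma n k) x y) :
    toB0Aux n k (GammaAlgebra.ofPath p) = B0.val p :=
  pathLift_ofPath B0.completeOrthogonalIdempotents_vertex B0.isRep_arrowVal p

theorem toB0Aux_vertex (x : IState n k) : toB0Aux n k (vertex x) = B0.vertex x :=
  toB0Aux_ofPath _

theorem toB0Aux_u (i : Fin n) :
    toB0Aux n k (GammaAlgebra.u i) = algebraMap (UPoly n) (B0 n k) (MvPolynomial.X i) := by
  rw [Algebra.algebraMap_eq_smul_one, GammaAlgebra.u, map_sum,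
    ← B0.completeOrthogonalIdempotents_vertex.complete, Finset.smul_sum]
  refine Finset.sum_congr rfl fun x _ => ?_
  rw [toB0Aux_ofPath, B0.val, uLoop, pathVal_arrowPath B0.isRep_arrowVal, ← B0.f_self]
  rfl

theorem toB0Aux_algebraMap (p : UPoly n) :
    toB0Aux n k (algebraMap (UPoly n) (GammaAlgebra n k) p) = algebraMap (UPoly n) (B0 n k) p := by
  have h : (toB0Aux n k).toRingHom.comp (algebraMap (UPoly n) (GammaAlgebra n k)) =
      algebraMap (UPoly n) (B0 n k) := by
    -- There is at most one ring homomorphism out of `𝔽₂`, so only the variables need checking.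
    refine MvPolynomial.ringHom_ext' (Subsingleton.elim _ _) fun i => ?_
    refine Eq.trans ?_ (toB0Aux_u i)
    have := X_smul i (1 : GammaAlgebra n k)
    rw [← Algebra.algebraMap_eq_smul_one, mul_one] at this
    exact congrArg (toB0Aux n k) this
  exact RingHom.congr_fun h p

/-- The homomorphism to `B_0(n,k)`. -/
def toB0 (n k : ℕ) : GammaAlgebra n k →ₐ[UPoly n] B0 n k :=
  { (toB0Aux n k).toRingHom with commutes' := toB0Aux_algebraMap }

theorem toB0_vertex (x : IState n k) : toB0 n k (vertex x) = B0.vertex x := toB0Aux_vertex x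

theorem toB0_arrow {l : Label n} {x y : IState n k} (h : IsArrow l x y) :
    toB0 n k (arrow h) = B0.coeff l • B0.f x y :=
  (toB0Aux_ofPath _).trans (pathVal_arrowPath B0.isRep_arrowVal _)

/-- Each letter split off γ has monomial `1` relative to the target `y`, so the images `f` of its
arrows multiply to `f x y` without a factor. -/
theorem toB0_gammaElt (x y : IState n k) : toB0 n k (gammaElt x y) = B0.f x y := by
  induction x using gammaElt_induction y with
  | refl => rw [gammaElt_self, toB0_vertex, B0.f_self]
  | step x x' h1 h2 h3 ih =>
    have h4 := h2 y
    have h5 : toB0 n k (gammaElt x x') = B0.f x x' := by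
      rcases h3 with ⟨i, h⟩ | ⟨i, h⟩
      · rw [← arrow_R_eq_gammaElt h, toB0_arrow, B0.coeff, one_smul]
      · rw [← arrow_L_eq_gammaElt h, toB0_arrow, B0.coeff, one_smul]
    rw [h1, one_smul] at h4
    rw [← h4, map_mul, ih, h5, B0.f_mul_f, h1, one_smul]

end GammaAlgebra

/-! ### The inverse homomorphism -/

namespace B0

theorem isRep_gammaElt :
    IsRep (Q := completeQuiver n k) (GammaAlgebra.vertex : IState n k → GammaAlgebra n k)
      (fun {x y} _ => GammaAlgebra.gammaElt x y) where
  left _ := GammaAlgebra.vertex_mul_gammaElt _ _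
  right _ := GammaAlgebra.gammaElt_mul_vertex _ _

/-- The homomorphism to the quiver algebra. -/
def toGamma (n k : ℕ) : B0 n k →ₐ[UPoly n] GammaAlgebra n k :=
  quivLift (pathLift GammaAlgebra.completeOrthogonalIdempotents_vertex isRep_gammaElt) (by
    have h (x y : IState n k) :
        pathLift (𝕜 := UPoly n) GammaAlgebra.completeOrthogonalIdempotents_vertex isRep_gammaElt
          (fArrow x y) = GammaAlgebra.gammaElt x y :=
      (pathLift_ofPath _ _ _).trans (pathVal_arrowPath isRep_gammaElt _)
    rintro _ (x | ⟨x, y, z⟩)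
    · rw [map_sub, h, pathLift_idem, GammaAlgebra.gammaElt_self, sub_self]
    · rw [map_sub, map_mul, map_smul, h, h, h, GammaAlgebra.gammaElt_mul_gammaElt, sub_self])

theorem toGamma_f (x y : IState n k) : toGamma n k (f x y) = GammaAlgebra.gammaElt x y :=
  (pathLift_ofPath GammaAlgebra.completeOrthogonalIdempotents_vertex isRep_gammaElt _).trans
    (pathVal_arrowPath isRep_gammaElt _)

theorem toGamma_vertex (x : IState n k) : toGamma n k (vertex x) = GammaAlgebra.vertex x :=
  pathLift_idem GammaAlgebra.completeOrthogonalIdempotents_vertex isRep_gammaElt x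

theorem toB0_toGamma (b : B0 n k) : GammaAlgebra.toB0 n k (toGamma n k b) = b := by
  induction b using quiv_induction with
  | h0 => simp only [map_zero]
  | hadd a b ha hb => rw [map_add, map_add, ha, hb]
  | hsmul c a ha => rw [map_smul, map_smul, ha]
  | hmul a b ha hb => rw [map_mul, map_mul, ha, hb]
  | hidem x =>
    exact (congrArg _ (toGamma_vertex x)).trans (GammaAlgebra.toB0_vertex x)
  | harrow x y e =>
    exact (congrArg _ (toGamma_f x y)).trans (GammaAlgebra.toB0_gammaElt x y)

theorem toGamma_toB0 (a : GammaAlgebra n k) : toGamma n k (GammaAlgebra.toB0 n k a) = a := by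
  induction a using quiv_induction with
  | h0 => simp only [map_zero]
  | hadd a b ha hb => rw [map_add, map_add, ha, hb]
  | hsmul c a ha =>
    -- Scalars here lie in `𝔽₂`, whereas the maps are linear over the polynomial ring; only `0` and
    -- `1` occur, so this causes no conflict.
    have h : c = 0 ∨ c = 1 := by
      revert c
      decide
    rcases h with rfl | rfl
    · rw [zero_smul, map_zero, map_zero]
    · rw [one_smul, ha]
  | hmul a b ha hb => rw [map_mul, map_mul, ha, hb]
  | hidem x =>
    exact (congrArg _ (GammaAlgebra.toB0_vertex x)).trans (toGamma_vertex x)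
  | harrow x y e =>
    obtain ⟨l, h⟩ := e
    refine (congrArg _ (GammaAlgebra.toB0_arrow h)).trans ?_
    rw [map_smul, toGamma_f]
    cases l with
    | R i => rw [coeff, one_smul, ← GammaAlgebra.arrow_R_eq_gammaElt h]; rfl
    | L i => rw [coeff, one_smul, ← GammaAlgebra.arrow_L_eq_gammaElt h]; rfl
    | U i =>
      cases h
      rw [coeff, GammaAlgebra.gammaElt_self, ← GammaAlgebra.uLoop_eq]; rfl

end B0

/-- The isomorphism between the quiver algebra and `B_0(n,k)`. -/
def GammaAlgebra.equivB0 (n k : ℕ) : GammaAlgebra n k ≃ₐ[UPoly n] B0 n k :=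
  AlgEquiv.ofAlgHom (GammaAlgebra.toB0 n k) (B0.toGamma n k) (AlgHom.ext B0.toB0_toGamma)
    (AlgHom.ext B0.toGamma_toB0)

theorem GammaAlgebra.equivB0_baseHom (p : IState n k → UPoly n) :
    GammaAlgebra.equivB0 n k (GammaAlgebra.baseHom n k p) = B0.baseHom n k p := by
  change GammaAlgebra.equivB0 n k (∑ x, p x • GammaAlgebra.vertex x) = ∑ x, p x • B0.vertex x
  rw [map_sum]
  exact Finset.sum_congr rfl fun x _ => by
    rw [map_smul]; exact congrArg _ (GammaAlgebra.toB0_vertex x)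

end OSz

end

/-- There is a ring isomorphism `F` from the quiver algebra of `Γ(n,k)` to `B_0(n,k)` that is
compatible with the structures of algebras over `𝔽₂[U_1, …, U_n]^{V(n,k)}`, sends each arrow from
`x` to `y` with label `R_i` or `L_i` to `f_{x,y}`, and whose inverse sends `f_{x,y}` to the class of
the path `γ_{x,y}`. -/
theorem theorem1p1 (n k : ℕ) :
    ∃ F : OSz.GammaAlgebra n k ≃+* OSz.B0 n k,
      (∀ p : OSz.IState n k → OSz.UPoly n,
        F (OSz.GammaAlgebra.baseHom n k p) = OSz.B0.baseHom n k p) ∧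
      (∀ (x y : OSz.IState n k) (e : (OSz.Gamma n k).Hom x y),
        (∀ i : Fin n, e.1 ≠ OSz.Label.U i) →
          F (OSz.GammaAlgebra.ofPath (OSz.arrowPath (OSz.Gamma n k) e)) = OSz.B0.f x y) ∧
      (∀ x y : OSz.IState n k,
        (∃! γ : OSz.QPath (OSz.Gamma n k) x y, OSz.IsGammaPath γ) ∧
          ∀ γ : OSz.QPath (OSz.Gamma n k) x y, OSz.IsGammaPath γ →
            F.symm (OSz.B0.f x y) = OSz.GammaAlgebra.ofPath γ) := by
  refine ⟨(OSz.GammaAlgebra.equivB0 n k).toRingEquiv, OSz.GammaAlgebra.equivB0_baseHom, ?_, ?_⟩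
  · rintro x y ⟨l, h⟩ hl
    refine (OSz.GammaAlgebra.toB0_arrow h).trans ?_
    cases l with
    | R i => exact one_smul _ _
    | L i => exact one_smul _ _
    | U i => exact absurd rfl (hl i)
  · intro x y
    obtain ⟨γ, hγ⟩ := OSz.exists_isGammaPath x y
    exact ⟨⟨γ, hγ, fun γ' h => h.unique hγ⟩,
      fun γ' h => (OSz.B0.toGamma_f x y).trans h.ofPath_eq.symm⟩
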